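/- All graphs are finite and simple. A \emph{hole} of a graph $G$ is an induced cycle of length at least $4$; $G$ is \emph{chordal} if it has no hole. A \emph{chordal completion} of $G$ is a chordal graph on $V(G)$ whose edge set contains $E(G)$. Write $\omega$ for the clique number and $\Omega(G)$ for the union of the vertex sets of all holes of $G$. A \emph{hole cover} of $G$ is a nonempty set $C\subseteq V(G)$ meeting every hole of $G$. A vertex $u$ has the \emph{NC property} in $G$ if no hole containing $u$ shares two consecutive edges with a hole not containing $u$; a set $C\subseteq V(G)$ has the \emph{NC property} in $G$ if each of its vertices does and every hole of $G$ contains at most one vertex of $C$. \emph{Locally chordalizing} $G$ by a vertex $u$ means joining $u$ to all other vertices of every hole of $G$ that contains $u$. If a hole cover $C$ of $G$ has the NC property, then $\widehat{G}(C)$ denotes the graph obtained from $G$ by locally chordalizing successively by the vertices of $C$, one after the other in any order (the result does not depend on the order). A \emph{local chordalization partition} of a hole cover $C$ of $G$ is an ordered partition $(C_1,\dots,C_k)$ of $C$, $k\ge 1$, such that, with $G_0^*=G-C$ and, for $i=1,\dots,k$, $$V(G_i)=V(G_{i-1}^*)\cup C_i,\quad E(G_i)=E(G_{i-1}^*)\cup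 E\Big(G-\bigcup_{j=i+1}^k C_j\Big),\quad G_i^*=\widehat{G_i}(C_i),$$ each $C_i$ is a hole cover of $G_i$ with the NC property in $G_i$ and each $G_i^*$ is chordal. The \emph{non-chordality index} $i(G)$ is $0$ if $G$ is chordal, and otherwise the smallest $k$ for which some hole cover of $G$ has a local chordalization partition into $k$ parts. Let $I_m$ be the edgeless graph on $m$ vertices, $K_n$ the complete graph on $n$ vertices, and $\vee$ the join of graphs. Let $\chi_{DP}(G)$ be the DP-chromatic (correspondence chromatic) number, i.e. the least $k$ such that, for all lists $L(v)$ of at least $k$ colors $(v\in V(G))$ and all choices of a (possibly non-perfect) matching $M_{uv}$ between $\{u\}\times L(u)$ and $\{v\}\times L(v)$ for each edge $uv$, there are colors $c(v)\in L(v)$ such that $(u,c(u))$ and $(v,c(v))$ are not matched in $M_{uv}$ for any edge $uv$. \textbf{Theorem.} Let $m\ge n\ge 1$ be integers and let $G$ be a non-chordal graph that does not contain $I_m\vee K_n$ as a subgraph (not necessarily induced) and satisfies $\omega(G[\Omega(G)])+i(G)\le m$. Then $G$ has a chordal completion $G^*$ with $\omega(G^*)<m+n$, and moreover $\chi_{DP}(G)<m+n$.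 -/

import Mathlib

namespace SimpleGraph

section Holes

variable {V : Type*}

/-- `G.IsHole S`: the set `S` is the vertex set of an induced cycle of length at least `4` of `G`.
An induced cycle is determined by its vertex set, so holes are identified with their vertex sets;
the edges of the hole are the edges of `G` with both ends in `S`. -/
def IsHole (G : SimpleGraph V) (S : Set V) : Prop :=
  ∃ n : ℕ, 4 ≤ n ∧ ∃ f : cycleGraph n ↪g G, Set.range f = S

/-- A graph is chordal if it has no hole. -/
def IsChordal (G : SimpleGraph V) : Prop :=
  ∀ S : Set V, ¬ G.IsHole S

/-- `G'` is a chordal completion of `G`: a chordal spanning supergraph. -/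
def IsChordalCompletion (G G' : SimpleGraph V) : Prop :=
  G ≤ G' ∧ G'.IsChordal

/-- The union `Ω(G)` of the vertex sets of all holes of `G`. -/
def holeUnion (G : SimpleGraph V) : Set V :=
  {v | ∃ S : Set V, G.IsHole S ∧ v ∈ S}

/-- A hole cover: a nonempty vertex set that meets every hole. -/
def IsHoleCover (G : SimpleGraph V) (C : Set V) : Prop :=
  C.Nonempty ∧ ∀ S : Set V, G.IsHole S → (S ∩ C).Nonempty

/-- The holes `S` and `T` of `G` share two consecutive edges `xv` and `vy`. -/
def ShareConsecutiveEdges (G : SimpleGraph V) (S T : Set V) : Prop :=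
  ∃ x v y : V, x ≠ y ∧ G.Adj x v ∧ G.Adj v y ∧ {x, v, y} ⊆ S ∩ T

/-- The non-consecutive property of a vertex `u`: no hole containing `u` shares consecutive edges
with a hole not containing `u`. -/
def VertexNC (G : SimpleGraph V) (u : V) : Prop :=
  ∀ S T : Set V, G.IsHole S → u ∈ S → G.IsHole T → u ∉ T → ¬ G.ShareConsecutiveEdges S T

/-- The non-consecutive property of a vertex set `C`: each of its vertices has it, and every hole
contains at most one vertex of `C`. -/
def SetNC (G : SimpleGraph V) (C : Set V) : Prop :=
  (∀ u ∈ C, G.VertexNC u) ∧ ∀ S : Set V, G.IsHole S → (S ∩ C).Subsingleton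

/-- The graph obtained by locally chordalizing all the holes of `G` containing `u` by `u`: the
vertex `u` is joined to every other vertex of each hole containing it. -/
def localChordalize (G : SimpleGraph V) (u : V) : SimpleGraph V :=
  G ⊔ fromRel (fun a b => a = u ∧ ∃ S : Set V, G.IsHole S ∧ u ∈ S ∧ b ∈ S)

/-- `G'` is obtained from `G` by applying local chordalizations recursively by the vertices of `C`,
taken one after the other, each exactly once, in some order. -/
def IsLocalChordalization (G : SimpleGraph V) (C : Set V) (G' : SimpleGraph V) : Prop :=
  ∃ l : List V, l.Nodup ∧ (∀ v, v ∈ l ↔ v ∈ C) ∧ l.foldl localChordalize G = G'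

/-- The graph `G - S`. The deleted vertices stay in the vertex type as isolated vertices, which
lie on no hole. -/
def removeVerts (G : SimpleGraph V) (S : Set V) : SimpleGraph V where
  Adj a b := G.Adj a b ∧ a ∉ S ∧ b ∉ S
  symm := ⟨fun _ _ h => ⟨h.1.symm, h.2.2, h.2.1⟩⟩
  loopless := ⟨fun _ h => h.1.ne rfl⟩

/-- `P 0, …, P (k - 1)` is a local chordalization partition of the hole cover `C` of `G`. Here
`B 0 = G - C`, and for each `i` the graph `A i` has the edges of `B i` and those of
`G - ⋃ j > i, P j`; `P i` is a hole cover of `A i` with the non-consecutive property, and `B (i + 1)`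
is the chordal graph obtained from `A i` by local chordalizations by the vertices of `P i`. -/
def IsLocalChordalizationPartition (G : SimpleGraph V) (C : Set V) {k : ℕ} (P : Fin k → Set V) :
    Prop :=
  G.IsHoleCover C ∧ Pairwise (fun i j => Disjoint (P i) (P j)) ∧ ⋃ i, P i = C ∧
  ∃ (A : Fin k → SimpleGraph V) (B : Fin (k + 1) → SimpleGraph V),
    B 0 = G.removeVerts C ∧
    ∀ i : Fin k,
      A i = B i.castSucc ⊔ G.removeVerts (⋃ j : Fin k, ⋃ _ : i < j, P j) ∧
      (A i).IsHoleCover (P i) ∧ (A i).SetNC (P i) ∧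
      (A i).IsLocalChordalization (P i) (B i.succ) ∧ (B i.succ).IsChordal

open Classical in
/-- The non-chordality index `i(G)`: it is `0` if `G` is chordal, and otherwise the smallest number
of parts of a local chordalization partition of a hole cover of `G`. -/
noncomputable def nonChordalityIndex (G : SimpleGraph V) : ℕ :=
  if G.IsChordal then 0
  else sInf {k : ℕ | 0 < k ∧ ∃ (C : Set V) (P : Fin k → Set V),
    G.IsLocalChordalizationPartition C P}

end Holes

section Join

/-- The join of two graphs: their disjoint union together with all edges between them. -/
def join {V W : Type*} (G : SimpleGraph V) (H : SimpleGraph W) : SimpleGraph (V ⊕ W) :=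
  (G ⊕g H) ⊔ completeBipartiteGraph V W

end Join

section DPColoring

variable {V : Type*}

/-- A correspondence assignment for `G`: a list of colors `L v` for every vertex `v`, and for every
edge `uv` a (not necessarily perfect) matching between `{u} × L u` and `{v} × L v`.
`M u v a b` says that `(u, a)` and `(v, b)` are matched. -/
structure CorrespondenceAssignment (G : SimpleGraph V) where
  L : V → Finset ℕ
  M : V → V → ℕ → ℕ → Prop
  mem_of_matched : ∀ u v a b, G.Adj u v → M u v a b → a ∈ L u ∧ b ∈ L v
  matched_symm : ∀ u v a b, G.Adj u v → M u v a b → M v u b a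
  matching : ∀ u v a b b', G.Adj u v → M u v a b → M u v a b' → b = b'

/-- A coloring from the lists in which no edge has the colors of its ends matched. -/
def CorrespondenceAssignment.Colorable {G : SimpleGraph V} (𝒞 : G.CorrespondenceAssignment) :
    Prop :=
  ∃ c : V → ℕ, (∀ v, c v ∈ 𝒞.L v) ∧ ∀ u v, G.Adj u v → ¬ 𝒞.M u v (c u) (c v)

/-- `G` is colorable for every correspondence assignment whose lists have at least `k` colors. -/
def DPColorable (G : SimpleGraph V) (k : ℕ) : Prop :=
  ∀ 𝒞 : G.CorrespondenceAssignment, (∀ v, k ≤ (𝒞.L v).card) → 𝒞.Colorable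

/-- The DP-chromatic number `χ_DP(G)`: the least `k` such that `G` is DP-`k`-colorable (`⊤` if there
is none). -/
noncomputable def dpChromaticNumber (G : SimpleGraph V) : ℕ∞ :=
  ⨅ k ∈ {k : ℕ | G.DPColorable k}, (k : ℕ∞)

end DPColoring

end SimpleGraph

/-!
The last graph `B` of a shortest local chordalization partition of `G` is the required completion.

Two facts about `B` are needed. First, every edge added to `G` has both ends in `Ω(G)`. This is
proved along the partition for an invariant (`IsFilling`) saying in addition that, for a vertex `z`
on no hole of `G`, the ends of an added edge are both adjacent to `z` or are linked in `G` by a walk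
around the neighbours of `z`. Replacing added edges by such walks, a hole of an intermediate graph
through `z` would give a hole of `G` through `z` (`IsFilling.mem_holeUnion`), and the invariant
passes on to the pairs of vertices of a common hole (`IsFilling.linkedIn_of_not_adj`).

Second, each part of the partition increases cliques by at most one vertex. Local chordalization by
a vertex with the non-consecutive property creates no new holes
(`VertexNC.isHole_of_localChordalize`), so all edges added for one part `C` join a vertex of `C` to
a vertex of a common hole of the same graph. By the non-consecutive property, the added edges inside
one clique have a common end in `C` (`SetNC.false_of_new_edges`); deleting it leaves a clique of the
previous graph. Hence every clique of `B` becomes a clique of `G` by deleting at most `i(G)`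
vertices. That the infimum defining `i(G)` is over a nonempty set is
`exists_isLocalChordalizationPartition`.

A clique of `B` with `m + n` vertices thus has at most `ω(G[Ω(G)]) + i(G) ≤ m` vertices in `Ω(G)`,
and at least `n` outside; the latter are adjacent in `G` to the whole clique, which yields
`I_m ∨ K_n` in `G` (`IsFilling.cliqueNum_lt`). Finally, chordal graphs have simplicial vertices
(`IsChordal.exists_simplicial`), so greedy colouring gives `χ_DP(G) ≤ ω(B)`.

All holes are produced in the same way, by `exists_isHole_of_linkedIn`.
-/

namespace SimpleGraph

variable {V : Type*}

/-! ### Holes as cyclic sequences -/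

lemma cycleGraph_adj_iff_of_lt {n : ℕ} (hn : 4 ≤ n) {a b : Fin n} (h : a < b) :
    (cycleGraph n).Adj a b ↔ b.val = a.val + 1 ∨ (a.val = 0 ∧ b.val = n - 1) := by
  rw [cycleGraph_adj']
  have hb := b.isLt
  have h' : a.val < b.val := h
  have h1 : (a - b).val = n - b.val + a.val := by
    rw [Fin.sub_def]
    exact Nat.mod_eq_of_lt (by omega)
  have h2 : (b - a).val = b.val - a.val := Fin.sub_val_of_le h.le
  rw [h1, h2]
  omega

/-- `g 0, g 1, …, g (n - 1), g n = g 0` runs once around an induced cycle of length `n ≥ 4`. -/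
structure IsHoleCycle (G : SimpleGraph V) (n : ℕ) (g : ℕ → V) : Prop where
  four_le : 4 ≤ n
  closed : g n = g 0
  ne : ∀ i j, i < j → j < n → g i ≠ g j
  adj_iff : ∀ i j, i < j → j < n → (G.Adj (g i) (g j) ↔ j = i + 1 ∨ (i = 0 ∧ j = n - 1))

variable {G : SimpleGraph V}

lemma IsHoleCycle.isHole {n : ℕ} {g : ℕ → V} (h : G.IsHoleCycle n g) :
    G.IsHole (g '' {i | i < n}) := by
  have hn := h.four_le
  have hinj : Function.Injective (fun k : Fin n => g k.val) := by
    intro a b hab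
    by_contra hne
    rcases lt_or_gt_of_ne hne with hl | hl
    · exact h.ne _ _ hl b.isLt hab
    · exact h.ne _ _ hl a.isLt hab.symm
  refine ⟨n, hn, ⟨⟨fun k => g k.val, hinj⟩, ?_⟩, ?_⟩
  · intro a b
    change G.Adj (g a) (g b) ↔ _
    rcases lt_trichotomy a b with hl | rfl | hl
    · rw [h.adj_iff _ _ hl b.isLt, cycleGraph_adj_iff_of_lt hn hl]
    · simp
    · rw [G.adj_comm, (cycleGraph n).adj_comm, h.adj_iff _ _ hl a.isLt,
        cycleGraph_adj_iff_of_lt hn hl]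
  · ext v
    constructor
    · rintro ⟨k, rfl⟩
      exact ⟨k, k.isLt, rfl⟩
    · rintro ⟨k, hk, rfl⟩
      exact ⟨⟨k, hk⟩, rfl⟩

/-- Every hole can be traversed starting from any of its vertices. -/
lemma IsHole.exists_isHoleCycle {S : Set V} (hS : G.IsHole S) {u : V} (hu : u ∈ S) :
    ∃ n g, G.IsHoleCycle n g ∧ g 0 = u ∧ g '' {i | i < n} = S := by
  obtain ⟨n, hn, f, rfl⟩ := hS
  obtain ⟨a, rfl⟩ := hu
  have hpos : 0 < n := by omega
  have ha := a.isLt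
  have hmod : ∀ x, x < 2 * n → (x < n ∧ x % n = x) ∨ (n ≤ x ∧ x % n = x - n) := by
    intro x hx
    rcases lt_or_ge x n with h | h
    · exact Or.inl ⟨h, Nat.mod_eq_of_lt h⟩
    · refine Or.inr ⟨h, ?_⟩
      rw [Nat.mod_eq_sub_mod h]
      exact Nat.mod_eq_of_lt (by omega)
  refine ⟨n, fun k => f ⟨(a.val + k) % n, Nat.mod_lt _ hpos⟩, ⟨hn, ?_, ?_, ?_⟩, ?_, ?_⟩
  · simp
  · intro i j hij hj heq
    have h1 := congrArg Fin.val (f.injective heq)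
    simp only at h1
    rcases hmod (a.val + i) (by omega) with h | h <;>
      rcases hmod (a.val + j) (by omega) with h' | h' <;> omega
  · intro i j hij hj
    rw [f.map_adj_iff]
    rcases hmod (a.val + i) (by omega) with h | h <;>
      rcases hmod (a.val + j) (by omega) with h' | h'
    · rw [cycleGraph_adj_iff_of_lt hn (by rw [Fin.mk_lt_mk]; omega)]
      simp only; omega
    · rw [adj_comm, cycleGraph_adj_iff_of_lt hn (by rw [Fin.mk_lt_mk]; omega)]
      simp only; omega
    · omega
    · rw [cycleGraph_adj_iff_of_lt hn (by rw [Fin.mk_lt_mk]; omega)]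
      simp only; omega
  · simp [Nat.mod_eq_of_lt ha]
  · ext v
    constructor
    · rintro ⟨k, -, rfl⟩
      exact ⟨_, rfl⟩
    · rintro ⟨b, rfl⟩
      have hb := b.isLt
      rcases le_or_gt a.val b.val with h | h
      · refine ⟨b.val - a.val, show _ < n by omega, congrArg f (Fin.ext ?_)⟩
        simp only
        rcases hmod (a.val + (b.val - a.val)) (by omega) with h | h <;> omega
      · refine ⟨b.val + n - a.val, show _ < n by omega, congrArg f (Fin.ext ?_)⟩
        simp only
        rcases hmod (a.val + (b.val + n - a.val)) (by omega) with h | h <;> omega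

lemma IsHoleCycle.adj_succ {n : ℕ} {g : ℕ → V} (h : G.IsHoleCycle n g) {i : ℕ} (hi : i < n) :
    G.Adj (g i) (g (i + 1)) := by
  have hn := h.four_le
  rcases Nat.lt_or_ge (i + 1) n with h1 | h1
  · exact (h.adj_iff i (i + 1) (by omega) h1).2 (Or.inl rfl)
  · obtain rfl : i + 1 = n := by omega
    rw [h.closed]
    exact ((h.adj_iff 0 i (by omega) hi).2 (Or.inr ⟨rfl, by omega⟩)).symm

/-! ### Linkage inside a vertex set -/

/-- The vertices `a` and `b` are joined by a walk of `G` all of whose vertices lie in `D`. -/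
def LinkedIn (G : SimpleGraph V) (D : Set V) (a b : V) : Prop :=
  ∃ p : G.Walk a b, ∀ v ∈ p.support, v ∈ D

namespace LinkedIn

variable {D E : Set V} {a b c : V}

lemma refl (h : a ∈ D) : G.LinkedIn D a a := ⟨.nil, by simpa using h⟩

lemma of_adj (hab : G.Adj a b) (ha : a ∈ D) (hb : b ∈ D) : G.LinkedIn D a b :=
  ⟨hab.toWalk, by simp [ha, hb]⟩

lemma mono (h : G.LinkedIn D a b) (hDE : D ⊆ E) : G.LinkedIn E a b :=
  let ⟨p, hp⟩ := h; ⟨p, fun v hv => hDE (hp v hv)⟩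

lemma symm (h : G.LinkedIn D a b) : G.LinkedIn D b a :=
  let ⟨p, hp⟩ := h; ⟨p.reverse, fun v hv => hp v (by simpa using hv)⟩

lemma trans (h : G.LinkedIn D a b) (h' : G.LinkedIn D b c) : G.LinkedIn D a c := by
  obtain ⟨p, hp⟩ := h
  obtain ⟨q, hq⟩ := h'
  refine ⟨p.append q, fun v hv => ?_⟩
  rw [Walk.mem_support_append_iff] at hv
  exact hv.elim (hp v) (hq v)

lemma left_mem (h : G.LinkedIn D a b) : a ∈ D := let ⟨p, hp⟩ := h; hp a p.start_mem_support

lemma right_mem (h : G.LinkedIn D a b) : b ∈ D := let ⟨p, hp⟩ := h; hp b p.end_mem_support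

/-- A linkage between distinct vertices can be chosen not to return to its first vertex. -/
lemma exists_adj (h : G.LinkedIn D a b) (hab : a ≠ b) :
    ∃ c ∈ D, G.Adj a c ∧ G.LinkedIn (D \ {a}) c b := by
  classical
  obtain ⟨p, hp⟩ := h
  have hqp : ∀ v ∈ p.bypass.support, v ∈ D := fun v hv =>
    hp v (p.support_bypass_subset_support hv)
  have hq := p.bypass_isPath
  generalize p.bypass = q at hqp hq
  cases q with
  | nil => exact absurd rfl hab
  | cons hac r =>
    rename_i c
    rw [Walk.cons_isPath_iff] at hq
    refine ⟨c, hqp c (by simp), hac, r, fun v hv => ⟨hqp v (by simp [hv]), ?_⟩⟩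
    rintro rfl
    exact hq.2 hv

lemma of_succ {g : ℕ → V} {i j : ℕ} (hij : i ≤ j)
    (h : ∀ k, i ≤ k → k < j → G.LinkedIn D (g k) (g (k + 1))) (hi : g i ∈ D) :
    G.LinkedIn D (g i) (g j) := by
  induction j, hij using Nat.le_induction with
  | base => exact refl hi
  | succ j hj ih => exact (ih fun k h1 h2 => h k h1 (by omega)).trans (h j hj (by omega))

end LinkedIn

/-- The basic source of holes: a shortest walk between two nonadjacent neighbours of `z` through
non-neighbours of `z` closes up with `z` to a hole. -/
lemma exists_isHole_of_linkedIn {z a b : V} {D : Set V} (hza : G.Adj z a) (hzb : G.Adj z b)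
    (hne : a ≠ b) (hab : ¬ G.Adj a b) (hz : z ∉ D)
    (hD : ∀ v ∈ D, G.Adj z v → v = a ∨ v = b) (h : G.LinkedIn D a b) :
    ∃ S, G.IsHole S ∧ z ∈ S ∧ a ∈ S ∧ b ∈ S ∧ S ⊆ insert z D := by
  obtain ⟨p, hp⟩ := h
  let H := G.induce D
  let a' : D := ⟨a, hp a p.start_mem_support⟩
  let b' : D := ⟨b, hp b p.end_mem_support⟩
  have hreach : H.Reachable a' b' := (p.induce D hp).reachable
  obtain ⟨q, hq⟩ := hreach.exists_walk_length_eq_dist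
  have hlen : 2 ≤ q.length := by
    by_contra hlt
    have : q.length = 0 ∨ q.length = 1 := by omega
    rcases this with h0 | h1
    · exact hne (congrArg Subtype.val (Walk.eq_of_length_eq_zero h0))
    · exact hab (show H.Adj a' b' from Walk.adj_of_length_eq_one h1)
  have hdist : ∀ i ≤ q.length, H.dist a' (q.getVert i) = i := by
    intro i hi
    have h1 : H.dist a' (q.getVert i) ≤ i := by
      refine (dist_le (q.take i)).trans ?_
      rw [Walk.take_length]; omega
    have h2 : H.dist (q.getVert i) b' ≤ q.length - i := by
      refine (dist_le (q.drop i)).trans ?_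
      rw [Walk.drop_length]
    have h3 := (q.take i).reachable.dist_triangle_left b'
    omega
  have hval : ∀ i j, i < j → j ≤ q.length →
      ((q.getVert i : V) ≠ q.getVert j) ∧ (G.Adj (q.getVert i) (q.getVert j) ↔ j = i + 1) := by
    intro i j hij hj
    have di := hdist i (by omega)
    have dj := hdist j hj
    refine ⟨fun h => ?_, fun h => ?_, ?_⟩
    · rw [Subtype.ext h] at di; omega
    · have h' : H.Adj (q.getVert i) (q.getVert j) := h
      have h3 := (q.take i).reachable.dist_triangle_left (q.getVert j)
      rw [dist_eq_one_iff_adj.2 h', di, dj] at h3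
      omega
    · rintro rfl
      exact q.adj_getVert_succ (by omega)
  have h0 : (q.getVert 0 : V) = a := by simp [a']
  have hl : (q.getVert q.length : V) = b := by simp [b']
  have hzn : ∀ i, z ≠ q.getVert i := fun i h => hz (h ▸ (q.getVert i).2)
  let g : ℕ → V := fun k => if k = 0 ∨ k = q.length + 2 then z else q.getVert (k - 1)
  have hg0 : g 0 = z := by simp [g]
  have hg : ∀ k, k ≤ q.length → g (k + 1) = q.getVert k := by
    intro k hk
    have : ¬ (k + 1 = 0 ∨ k + 1 = q.length + 2) := by omega
    simp only [g, if_neg this, Nat.add_sub_cancel]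
  have hcyc : G.IsHoleCycle (q.length + 2) g := by
    refine ⟨by omega, by simp [g], ?_, ?_⟩
    · intro i j hij hj
      obtain ⟨j, rfl⟩ : ∃ j', j = j' + 1 := ⟨j - 1, by omega⟩
      rw [hg j (by omega)]
      rcases i with _ | i
      · rw [hg0]; exact hzn j
      · rw [hg i (by omega)]; exact (hval i j (by omega) (by omega)).1
    · intro i j hij hj
      obtain ⟨j, rfl⟩ : ∃ j', j = j' + 1 := ⟨j - 1, by omega⟩
      rw [hg j (by omega)]
      rcases i with _ | i
      · rw [hg0]
        constructor
        · intro hadj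
          rcases hD _ (q.getVert j).2 hadj with h | h
          · left
            by_contra hj0
            exact (hval 0 j (by omega) (by omega)).1 (h0.trans h.symm)
          · right
            refine ⟨rfl, ?_⟩
            by_contra hj0
            exact (hval j q.length (by omega) le_rfl).1 (h.trans hl.symm)
        · rintro (h | h)
          · obtain rfl : j = 0 := by omega
            rw [h0]; exact hza
          · obtain rfl : j = q.length := by omega
            rw [hl]; exact hzb
      · rw [hg i (by omega), (hval i j (by omega) (by omega)).2]
        omega
  refine ⟨_, hcyc.isHole, ⟨0, by simp, hg0⟩, ⟨1, by simp, (hg 0 (by omega)).trans h0⟩,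
    ⟨q.length + 1, by simp, (hg _ le_rfl).trans hl⟩, ?_⟩
  rintro _ ⟨k, hk, rfl⟩
  rcases k with _ | k
  · exact Or.inl hg0
  · right
    rw [hg k (Nat.lt_succ_iff.1 (Nat.lt_of_succ_lt_succ hk))]
    exact (q.getVert k).2

/-! ### The two arms of a hole between nonadjacent vertices -/

/-- `X` is one of the two arms of a hole strictly between its nonadjacent vertices `u` and `w`:
`x` is the only vertex of `X` adjacent to `u`, and `s` the only one adjacent to `w`. -/
structure IsArm (G : SimpleGraph V) (u w : V) (X : Set V) (x s : V) : Prop where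
  left_adj : G.Adj u x
  right_adj : G.Adj w s
  left_notMem : u ∉ X
  right_notMem : w ∉ X
  eq_left : ∀ c ∈ X, G.Adj u c → c = x
  eq_right : ∀ c ∈ X, G.Adj w c → c = s
  right_mem : s ∈ X
  linked : ∀ c ∈ X, G.LinkedIn X x c

lemma IsArm.symm {u w x s : V} {X : Set V} (h : G.IsArm u w X x s) : G.IsArm w u X s x :=
  ⟨h.right_adj, h.left_adj, h.right_notMem, h.left_notMem, h.eq_right, h.eq_left,
    (h.linked s h.right_mem).left_mem,
    fun c hc => (h.linked s h.right_mem).symm.trans (h.linked c hc)⟩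

lemma IsHoleCycle.isArm_left {n : ℕ} {g : ℕ → V} (hg : G.IsHoleCycle n g) {j : ℕ}
    (hj : 2 ≤ j) (hjn : j + 2 ≤ n) :
    G.IsArm (g 0) (g j) (g '' {k | 1 ≤ k ∧ k < j}) (g 1) (g (j - 1)) := by
  refine ⟨hg.adj_succ (by omega), ?_, ?_, ?_, ?_, ?_, ⟨j - 1, ⟨by omega, by omega⟩, rfl⟩, ?_⟩
  · have := hg.adj_succ (i := j - 1) (by omega)
    rw [Nat.sub_add_cancel (by omega)] at this
    exact this.symm
  · rintro ⟨k, ⟨h1, h2⟩, h⟩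
    exact hg.ne 0 k (by omega) (by omega) h.symm
  · rintro ⟨k, ⟨h1, h2⟩, h⟩
    exact hg.ne k j (by omega) (by omega) h
  · rintro _ ⟨k, ⟨h1, h2⟩, rfl⟩ h
    rw [hg.adj_iff 0 k (by omega) (by omega)] at h
    rw [show k = 1 by omega]
  · rintro _ ⟨k, ⟨h1, h2⟩, rfl⟩ h
    rw [adj_comm, hg.adj_iff k j (by omega) (by omega)] at h
    rw [show k = j - 1 by omega]
  · rintro _ ⟨k, ⟨h1, h2⟩, rfl⟩
    exact LinkedIn.of_succ h1 (fun i hi hi' => .of_adj (hg.adj_succ (by omega))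
      ⟨i, ⟨hi, by omega⟩, rfl⟩ ⟨i + 1, ⟨by omega, by omega⟩, rfl⟩) ⟨1, ⟨le_rfl, by omega⟩, rfl⟩

lemma IsHoleCycle.isArm_right {n : ℕ} {g : ℕ → V} (hg : G.IsHoleCycle n g) {j : ℕ}
    (hj : 2 ≤ j) (hjn : j + 2 ≤ n) :
    G.IsArm (g 0) (g j) (g '' {k | j < k ∧ k < n}) (g (n - 1)) (g (j + 1)) := by
  refine IsArm.symm ⟨hg.adj_succ (by omega), ?_, ?_, ?_, ?_, ?_,
    ⟨n - 1, ⟨by omega, by omega⟩, rfl⟩, ?_⟩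
  · exact (hg.adj_iff 0 (n - 1) (by omega) (by omega)).2 (Or.inr ⟨rfl, rfl⟩)
  · rintro ⟨k, ⟨h1, h2⟩, h⟩
    exact hg.ne j k (by omega) (by omega) h.symm
  · rintro ⟨k, ⟨h1, h2⟩, h⟩
    exact hg.ne 0 k (by omega) (by omega) h.symm
  · rintro _ ⟨k, ⟨h1, h2⟩, rfl⟩ h
    rw [hg.adj_iff j k (by omega) (by omega)] at h
    rw [show k = j + 1 by omega]
  · rintro _ ⟨k, ⟨h1, h2⟩, rfl⟩ h
    rw [hg.adj_iff 0 k (by omega) (by omega)] at h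
    rw [show k = n - 1 by omega]
  · rintro _ ⟨k, ⟨h1, h2⟩, rfl⟩
    exact LinkedIn.of_succ h1 (fun i hi hi' => .of_adj (hg.adj_succ (by omega))
      ⟨i, ⟨by omega, by omega⟩, rfl⟩ ⟨i + 1, ⟨by omega, by omega⟩, rfl⟩)
      ⟨j + 1, ⟨by omega, by omega⟩, rfl⟩

lemma IsHole.exists_arms {S : Set V} (hS : G.IsHole S) {u w : V} (hu : u ∈ S) (hw : w ∈ S)
    (hne : u ≠ w) (hadj : ¬ G.Adj u w) :
    ∃ X Y x y s t, G.IsArm u w X x s ∧ G.IsArm u w Y y t ∧ X ⊆ S ∧ Y ⊆ S ∧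
      x ≠ y ∧ ¬ G.Adj x y ∧ s ≠ t ∧ ¬ G.Adj s t := by
  obtain ⟨n, g, hg, rfl, rfl⟩ := hS.exists_isHoleCycle hu
  obtain ⟨j, hj, rfl⟩ := hw
  have hjn : j < n := hj
  have h4 := hg.four_le
  have hj0 : j ≠ 0 := by rintro rfl; exact hne rfl
  have h1 := (hg.adj_iff 0 j (by omega) hjn).not.1 hadj
  refine ⟨_, _, _, _, _, _, hg.isArm_left (j := j) (by omega) (by omega),
    hg.isArm_right (by omega) (by omega), ?_, ?_, hg.ne _ _ (by omega) (by omega), ?_,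
    hg.ne _ _ (by omega) (by omega), ?_⟩
  · rintro _ ⟨k, ⟨h1, h2⟩, rfl⟩
    exact ⟨k, show k < n by omega, rfl⟩
  · rintro _ ⟨k, ⟨h1, h2⟩, rfl⟩
    exact ⟨k, h2, rfl⟩
  · rw [hg.adj_iff _ _ (by omega) (by omega)]; omega
  · rw [hg.adj_iff _ _ (by omega) (by omega)]; omega

lemma IsHole.linkedIn_diff {S : Set V} (hS : G.IsHole S) {v a b : V} (hv : v ∈ S) (ha : a ∈ S)
    (hb : b ∈ S) (hav : a ≠ v) (hbv : b ≠ v) : G.LinkedIn (S \ {v}) a b := by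
  obtain ⟨n, g, hg, rfl, rfl⟩ := hS.exists_isHoleCycle hv
  have key : ∀ c ∈ g '' {i | i < n}, c ≠ g 0 →
      G.LinkedIn ((g '' {i | i < n}) \ {g 0}) (g 1) c := by
    rintro _ ⟨k, hk, rfl⟩ hk0
    have hkn : k < n := hk
    have hk1 : k ≠ 0 := by rintro rfl; exact hk0 rfl
    have hmem : ∀ i, 1 ≤ i → i < n → g i ∈ (g '' {i | i < n}) \ {g 0} := fun i h1 h2 =>
      ⟨⟨i, h2, rfl⟩, fun h => hg.ne 0 i (by omega) h2 (Eq.symm h)⟩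
    exact LinkedIn.of_succ (by omega) (fun i h1 h2 => .of_adj (hg.adj_succ (by omega))
      (hmem i h1 (by omega)) (hmem (i + 1) (by omega) (by omega))) (hmem 1 le_rfl (by omega))
  exact (key a ha hav).symm.trans (key b hb hbv)

lemma IsHole.of_adj_iff {G' : SimpleGraph V} {S : Set V} (hS : G.IsHole S)
    (h : ∀ a ∈ S, ∀ b ∈ S, (G.Adj a b ↔ G'.Adj a b)) : G'.IsHole S := by
  obtain ⟨n, hn, f, rfl⟩ := hS
  refine ⟨n, hn, ⟨f.toEmbedding, fun {a b} => ?_⟩, rfl⟩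
  exact (h _ ⟨a, rfl⟩ _ ⟨b, rfl⟩).symm.trans f.map_adj_iff

/-! ### Local chordalization by a vertex with the non-consecutive property -/

lemma localChordalize_adj {u a b : V} : (G.localChordalize u).Adj a b ↔ G.Adj a b ∨ a ≠ b ∧
    ((a = u ∧ ∃ S, G.IsHole S ∧ u ∈ S ∧ b ∈ S) ∨ (b = u ∧ ∃ S, G.IsHole S ∧ u ∈ S ∧ a ∈ S)) := by
  simp [localChordalize]

/-- If `s a t` are consecutive on a hole through `v`, the non-consecutive property of `v` forbids
linking `s` to `t` through non-neighbours of `a` other than `v`. -/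
lemma VertexNC.not_linkedIn {v : V} (hv : G.VertexNC v) {S : Set V} (hS : G.IsHole S)
    (hvS : v ∈ S) {a s t : V} (ha : a ∈ S) (hs : s ∈ S) (ht : t ∈ S) (hva : v ≠ a)
    (has : G.Adj a s) (hat : G.Adj a t) (hne : s ≠ t) (hst : ¬ G.Adj s t) {D : Set V}
    (haD : a ∉ D) (hvD : v ∉ D) (hD : ∀ c ∈ D, G.Adj a c → c = s ∨ c = t) :
    ¬ G.LinkedIn D s t := by
  intro h
  obtain ⟨T, hT, haT, hsT, htT, hTD⟩ := exists_isHole_of_linkedIn has hat hne hst haD hD h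
  refine hv S T hS hvS hT (fun h => (hTD h).elim hva hvD) ⟨s, a, t, hne, has.symm, hat, ?_⟩
  rintro c (rfl | rfl | rfl)
  exacts [⟨hs, hsT⟩, ⟨ha, haT⟩, ⟨ht, htT⟩]

/-- Let `P` link `a` to `b` and consist of vertices that are on no hole with `v` and not adjacent
to `v`. Then any two sets `M ∋ a` and `N ∋ b` that reach the neighbourhood of `v` in a single
vertex must touch: otherwise they would close up through `P` to a hole that meets `P`. -/
lemma linkedIn_union_of_tethers {v a b x y : V} {M N P : Set V}
    (hP : ∀ c ∈ P, c ≠ v ∧ ¬ G.Adj v c ∧ ∀ S, G.IsHole S → v ∈ S → c ∉ S)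
    (hab : G.LinkedIn (insert a (insert b P)) a b)
    (hvM : v ∉ M) (hvx : G.Adj v x) (hMx : ∀ c ∈ M, G.Adj v c → c = x) (hM : G.LinkedIn M a x)
    (hvN : v ∉ N) (hvy : G.Adj v y) (hNy : ∀ c ∈ N, G.Adj v c → c = y) (hN : G.LinkedIn N b y) :
    G.LinkedIn (M ∪ N) a b := by
  have hM' := hM.mono (Set.subset_union_left (t := N))
  have hN' := hN.symm.mono (Set.subset_union_right (s := M))
  by_cases hxy : x = y
  · subst hxy
    exact hM'.trans hN'
  by_cases hadj : G.Adj x y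
  · exact (hM'.trans (.of_adj hadj hM'.right_mem hN'.left_mem)).trans hN'
  have hlink : G.LinkedIn (M ∪ N ∪ P) x y := by
    refine ((hM'.symm.mono Set.subset_union_left).trans (hab.mono ?_)).trans
      (hN'.symm.mono Set.subset_union_left)
    rintro c (rfl | rfl | hc)
    exacts [Or.inl (Or.inl hM.left_mem), Or.inl (Or.inr hN.left_mem), Or.inr hc]
  obtain ⟨S, hS, hvS, hxS, hyS, hSD⟩ := exists_isHole_of_linkedIn hvx hvy hxy hadj
    (by rintro ((h | h) | h); exacts [hvM h, hvN h, (hP v h).1 rfl])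
    (by
      rintro c ((h | h) | h) hc
      exacts [Or.inl (hMx c h hc), Or.inr (hNy c h hc), absurd hc (hP c h).2.1]) hlink
  have hxyl : G.LinkedIn (M ∪ N) x y := by
    refine (hS.linkedIn_diff hvS hxS hyS hvx.ne' hvy.ne').mono ?_
    rintro c ⟨hcS, hcv⟩
    rcases hSD hcS with h | h | h
    exacts [absurd h hcv, h, absurd hcS ((hP c h).2.2 S hS hvS)]
  exact (hM'.trans hxyl).trans hN'

/-- Local chordalization by `v` leaves no hole `v, a, P, b` in which `a` is a new neighbour
of `v`. -/
lemma VertexNC.false_of_linkedIn {v : V} (hv : G.VertexNC v) {a b : V} {P : Set V}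
    (hP : ∀ c ∈ P, c ≠ v ∧ ¬ G.Adj v c ∧ ∀ S, G.IsHole S → v ∈ S → c ∉ S)
    (hlink : G.LinkedIn (insert a (insert b P)) a b) (hne : a ≠ b) (hab : ¬ G.Adj a b)
    (hva : v ≠ a) (hvb : v ≠ b) (hna : ¬ G.Adj v a) (ha : ∃ S, G.IsHole S ∧ v ∈ S ∧ a ∈ S)
    (hb : G.Adj v b ∨ ∃ S, G.IsHole S ∧ v ∈ S ∧ b ∈ S) : False := by
  -- `b` reaches a neighbour of `v` through a set that `a` has no neighbour in
  have hN : ∃ N y, v ∉ N ∧ G.Adj v y ∧ (∀ c ∈ N, G.Adj v c → c = y) ∧ G.LinkedIn N b y ∧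
      ∀ c ∈ N, ¬ G.Adj a c := by
    by_cases hvb' : G.Adj v b
    · exact ⟨{b}, b, by simpa using hvb, hvb', by simp, .refl rfl, by simpa using hab⟩
    obtain ⟨S, hS, hvS, hbS⟩ := hb.resolve_left hvb'
    obtain ⟨X, Y, x, y, s, t, hX, hY, hXS, hYS, -, -, hst, hst'⟩ :=
      hS.exists_arms hvS hbS hvb hvb'
    have key : ∀ X x s, G.IsArm v b X x s → (∀ c ∈ X, ¬ G.Adj a c) →
        ∃ N y, v ∉ N ∧ G.Adj v y ∧ (∀ c ∈ N, G.Adj v c → c = y) ∧ G.LinkedIn N b y ∧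
        ∀ c ∈ N, ¬ G.Adj a c := by
      intro X x s hX haX
      refine ⟨insert b X, x, ?_, hX.left_adj, ?_, ?_, ?_⟩
      · rintro (h | h)
        exacts [hvb h, hX.left_notMem h]
      · rintro c (rfl | h) hc
        exacts [absurd hc hvb', hX.eq_left c h hc]
      · exact (LinkedIn.of_adj hX.right_adj (by simp) (Or.inr hX.right_mem)).trans
          ((hX.linked s hX.right_mem).symm.mono (Set.subset_insert _ _))
      · rintro c (rfl | h)
        exacts [hab, haX c h]
    by_cases haX : ∀ c ∈ X, ¬ G.Adj a c
    · exact key X x s hX haX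
    by_cases haY : ∀ c ∈ Y, ¬ G.Adj a c
    · exact key Y y t hY haY
    push Not at haX haY
    obtain ⟨c, hcX, hac⟩ := haX
    obtain ⟨d, hdY, had⟩ := haY
    -- otherwise `a` links the two neighbours of `b` on the hole through `v` and `b`
    exfalso
    refine hv.not_linkedIn hS hvS hbS (hXS hX.right_mem) (hYS hY.right_mem) hvb hX.right_adj
      hY.right_adj hst hst' (D := insert a (X ∪ Y)) ?_ ?_ ?_ ?_
    · rintro (h | h | h)
      exacts [hne h.symm, hX.right_notMem h, hY.right_notMem h]
    · rintro (h | h | h)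
      exacts [hva h, hX.left_notMem h, hY.left_notMem h]
    · rintro e (rfl | h | h) he
      exacts [absurd he.symm hab, Or.inl (hX.eq_right e h he), Or.inr (hY.eq_right e h he)]
    · have h1 := (hX.symm.linked c hcX).mono (Set.subset_union_left.trans
        (Set.subset_insert a (X ∪ Y)))
      have h2 := (hY.symm.linked d hdY).mono (Set.subset_union_right.trans
        (Set.subset_insert a (X ∪ Y)))
      exact ((h1.trans (.of_adj hac.symm h1.right_mem (by simp))).trans
        (.of_adj had (by simp) h2.right_mem)).trans h2.symm
  obtain ⟨N, y, hvN, hvy, hNy, hbN, haN⟩ := hN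
  obtain ⟨S, hS, hvS, haS⟩ := ha
  obtain ⟨X, Y, x, x', s, t, hX, hY, hXS, hYS, -, -, hst, hst'⟩ := hS.exists_arms hvS haS hva hna
  -- through `N`, both neighbours of `a` on the hole through `v` and `a` are linked to `b`
  have key : ∀ X x s, G.IsArm v a X x s → G.LinkedIn ((X ∪ N) \ {a}) s b := by
    intro X x s hX
    have h := linkedIn_union_of_tethers hP hlink (M := insert a X)
      (by rintro (h | h); exacts [hva h, hX.left_notMem h]) hX.left_adj
      (by rintro c (rfl | h) hc; exacts [absurd hc hna, hX.eq_left c h hc])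
      ((LinkedIn.of_adj hX.right_adj (by simp) (Or.inr hX.right_mem)).trans
        ((hX.linked s hX.right_mem).symm.mono (Set.subset_insert _ _))) hvN hvy hNy hbN
    obtain ⟨c, hc, hac, hcb⟩ := h.exists_adj hne
    have hcs : c = s := by
      rcases hc with (rfl | h) | h
      exacts [absurd rfl hac.ne, hX.eq_right c h hac, absurd hac (haN c h)]
    subst hcs
    refine hcb.mono ?_
    rintro d ⟨(h | h) | h, hda⟩
    exacts [absurd h hda, ⟨Or.inl h, hda⟩, ⟨Or.inr h, hda⟩]
  refine hv.not_linkedIn hS hvS haS (hXS hX.right_mem) (hYS hY.right_mem) hva hX.right_adj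
    hY.right_adj hst hst' (D := (X ∪ Y ∪ N) \ {a}) (by simp) ?_ ?_ ?_
  · rintro ⟨(h | h) | h, -⟩
    exacts [hX.left_notMem h, hY.left_notMem h, hvN h]
  · rintro c ⟨(h | h) | h, -⟩ hc
    exacts [Or.inl (hX.eq_right c h hc), Or.inr (hY.eq_right c h hc), absurd hc (haN c h)]
  · refine ((key X x s hX).mono ?_).trans ((key Y x' t hY).symm.mono ?_)
    · exact Set.sdiff_subset_sdiff_left (by
        rintro c (h | h)
        exacts [Or.inl (Or.inl h), Or.inr h])
    · exact Set.sdiff_subset_sdiff_left (by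
        rintro c (h | h)
        exacts [Or.inl (Or.inr h), Or.inr h])

/-- A hole through `v` that survives local chordalization by `v` is impossible. Its neighbours
`a`, `b` of `v` are tethered to the original neighbourhood of `v`, and the tethers must touch. -/
lemma VertexNC.notMem_of_isHole_localChordalize {v : V} (hv : G.VertexNC v) {T : Set V}
    (hT : (G.localChordalize v).IsHole T) : v ∉ T := by
  intro hvT
  obtain ⟨n, g, hg, rfl, rfl⟩ := hT.exists_isHoleCycle hvT
  have h4 := hg.four_le
  have hG : ∀ a b, (G.localChordalize (g 0)).Adj a b → a ≠ g 0 → b ≠ g 0 → G.Adj a b := by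
    intro a b h ha hb
    rw [localChordalize_adj] at h
    tauto
  have hne0 : ∀ i, 1 ≤ i → i < n → g i ≠ g 0 := fun i h1 h2 => (hg.ne 0 i (by omega) h2).symm
  have hends : ∀ i, (G.localChordalize (g 0)).Adj (g 0) (g i) →
      G.Adj (g 0) (g i) ∨ ∃ S, G.IsHole S ∧ g 0 ∈ S ∧ g i ∈ S := by
    intro i h
    rw [localChordalize_adj] at h
    rcases h with h | ⟨hne, ⟨-, h⟩ | ⟨h, -⟩⟩
    exacts [Or.inl h, Or.inr h, absurd h.symm hne]
  have ha := hends 1 ((hg.adj_iff 0 1 (by omega) (by omega)).2 (Or.inl rfl))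
  have hb := hends (n - 1) ((hg.adj_iff 0 (n - 1) (by omega) (by omega)).2 (Or.inr ⟨rfl, rfl⟩))
  have hab : ¬ G.Adj (g 1) (g (n - 1)) := fun h => by
    have := (hg.adj_iff 1 (n - 1) (by omega) (by omega)).1 (localChordalize_adj.2 (Or.inl h))
    omega
  have hne : g 1 ≠ g (n - 1) := hg.ne _ _ (by omega) (by omega)
  set P : Set V := g '' {k | 2 ≤ k ∧ k + 2 ≤ n}
  have hP : ∀ c ∈ P, c ≠ g 0 ∧ ¬ G.Adj (g 0) c ∧ ∀ S, G.IsHole S → g 0 ∈ S → c ∉ S := by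
    rintro _ ⟨k, ⟨h1, h2⟩, rfl⟩
    have hnadj : ¬ (G.localChordalize (g 0)).Adj (g 0) (g k) := by
      rw [hg.adj_iff 0 k (by omega) (by omega)]; omega
    rw [localChordalize_adj] at hnadj
    have hk := hne0 k (by omega) (by omega)
    refine ⟨hk, fun h => hnadj (Or.inl h), fun S hS h0 hkS => ?_⟩
    exact hnadj (Or.inr ⟨hk.symm, Or.inl ⟨rfl, S, hS, h0, hkS⟩⟩)
  have hlink : G.LinkedIn (insert (g 1) (insert (g (n - 1)) P)) (g 1) (g (n - 1)) := by
    have hmem : ∀ i, 1 ≤ i → i < n → g i ∈ insert (g 1) (insert (g (n - 1)) P) := by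
      intro i h1 h2
      rcases (by omega : i = 1 ∨ i = n - 1 ∨ (2 ≤ i ∧ i + 2 ≤ n)) with rfl | rfl | h
      exacts [Or.inl rfl, Or.inr (Or.inl rfl), Or.inr (Or.inr ⟨i, h, rfl⟩)]
    exact LinkedIn.of_succ (by omega) (fun i h1 h2 => .of_adj
      (hG _ _ (hg.adj_succ (by omega)) (hne0 i h1 (by omega)) (hne0 _ (by omega) (by omega)))
      (hmem i h1 (by omega)) (hmem _ (by omega) (by omega))) (hmem 1 le_rfl (by omega))
  have h1 := (hne0 1 (by omega) (by omega)).symm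
  have h2 := (hne0 (n - 1) (by omega) (by omega)).symm
  by_cases hna : G.Adj (g 0) (g 1)
  · by_cases hnb : G.Adj (g 0) (g (n - 1))
    · have h := linkedIn_union_of_tethers hP hlink (M := {g 1}) (N := {g (n - 1)}) (by simpa using h1)
        hna (by simp) (.refl rfl) (by simpa using h2) hnb (by simp) (.refl rfl)
      obtain ⟨c, hc | hc, hac, -⟩ := h.exists_adj hne
      exacts [hac.ne hc.symm, hab (hc ▸ hac)]
    · exact hv.false_of_linkedIn hP (by rw [Set.insert_comm]; exact hlink.symm) hne.symm
        (fun h => hab h.symm) h2 h1 hnb (hb.resolve_left hnb) ha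
  · exact hv.false_of_linkedIn hP hlink hne hab h1 h2 hna (ha.resolve_left hna) hb

/-- Local chordalization by a vertex with the non-consecutive property destroys the holes through
this vertex and creates no new ones. -/
lemma VertexNC.isHole_of_localChordalize {v : V} (hv : G.VertexNC v) {T : Set V}
    (hT : (G.localChordalize v).IsHole T) : G.IsHole T ∧ v ∉ T := by
  have hvT := hv.notMem_of_isHole_localChordalize hT
  refine ⟨hT.of_adj_iff fun a ha b hb => ?_, hvT⟩
  rw [localChordalize_adj]
  have ha' : a ≠ v := fun h => hvT (h ▸ ha)
  have hb' : b ≠ v := fun h => hvT (h ▸ hb)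
  tauto

/-- A graph all of whose holes pass through `v` becomes chordal by local chordalization. -/
lemma isChordal_localChordalize {v : V} (h : ∀ S, G.IsHole S → v ∈ S) :
    (G.localChordalize v).IsChordal := by
  have hv : G.VertexNC v := fun _ T _ _ hT hvT => absurd (h T hT) hvT
  intro T hT
  exact (hv.isHole_of_localChordalize hT).2 (h T (hv.isHole_of_localChordalize hT).1)

/-- Local chordalization by one vertex preserves the non-consecutive property of the others. -/
lemma VertexNC.localChordalize {v u : V} (hv : G.VertexNC v) (hu : G.VertexNC u) :
    (G.localChordalize v).VertexNC u := by
  rintro S T hS huS hT huT ⟨x, c, y, hxy, hxc, hcy, hsub⟩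
  obtain ⟨hS', hvS⟩ := hv.isHole_of_localChordalize hS
  refine hu S T hS' huS (hv.isHole_of_localChordalize hT).1 huT ⟨x, c, y, hxy, ?_, ?_, hsub⟩
  all_goals
    have hx : x ≠ v := by rintro rfl; exact hvS (hsub (by simp)).1
    have hc : c ≠ v := by rintro rfl; exact hvS (hsub (by simp)).1
    have hy : y ≠ v := by rintro rfl; exact hvS (hsub (by simp)).1
    rw [localChordalize_adj] at hxc hcy
    tauto

/-- Successive local chordalizations by vertices with the non-consecutive property only join such
vertices to vertices with which they share a hole of the original graph. -/
lemma foldl_localChordalize_adj (l : List V) (G : SimpleGraph V) (hl : ∀ u ∈ l, G.VertexNC u) :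
    G ≤ l.foldl localChordalize G ∧ ∀ a b, (l.foldl localChordalize G).Adj a b → G.Adj a b ∨
      ∃ S, G.IsHole S ∧ a ∈ S ∧ b ∈ S ∧ (a ∈ l ∨ b ∈ l) := by
  induction l generalizing G with
  | nil => exact ⟨le_rfl, fun a b h => Or.inl h⟩
  | cons v l ih =>
    have hv := hl v (by simp)
    obtain ⟨h1, h2⟩ := ih (G.localChordalize v) fun u hu => hv.localChordalize (hl u (by simp [hu]))
    refine ⟨le_sup_left.trans h1, fun a b hab => ?_⟩
    rcases h2 a b hab with h | ⟨S, hS, ha, hb, h⟩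
    · rw [localChordalize_adj] at h
      rcases h with h | ⟨-, ⟨rfl, S, hS, hu, hb⟩ | ⟨rfl, S, hS, hu, ha⟩⟩
      · exact Or.inl h
      · exact Or.inr ⟨S, hS, hu, hb, by simp⟩
      · exact Or.inr ⟨S, hS, ha, hu, by simp⟩
    · refine Or.inr ⟨S, (hv.isHole_of_localChordalize hS).1, ha, hb, ?_⟩
      exact h.imp (List.mem_cons_of_mem _) (List.mem_cons_of_mem _)

lemma IsLocalChordalization.adj {C : Set V} {G' : SimpleGraph V} (hC : G.SetNC C)
    (h : G.IsLocalChordalization C G') : G ≤ G' ∧ ∀ a b, G'.Adj a b → G.Adj a b ∨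
      ∃ S, G.IsHole S ∧ a ∈ S ∧ b ∈ S ∧ (a ∈ C ∨ b ∈ C) := by
  obtain ⟨l, -, hl, rfl⟩ := h
  simp_rw [← hl]
  exact foldl_localChordalize_adj l G fun u hu => hC.1 u ((hl u).1 hu)

/-! ### Cliques after a local chordalization -/

/-- Adjacent vertices `u`, `u'` of a set with the non-consecutive property are not both on holes
with a common non-neighbour `w`. -/
lemma SetNC.false_of_isHole_of_isHole {C : Set V} (hC : G.SetNC C) {u u' w : V} (hu : u ∈ C)
    (hu' : u' ∈ C) (hadj : G.Adj u u') {S S' : Set V} (hS : G.IsHole S) (hS' : G.IsHole S')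
    (huS : u ∈ S) (hwS : w ∈ S) (hu'S' : u' ∈ S') (hwS' : w ∈ S') (huw : ¬ G.Adj u w)
    (hu'w : ¬ G.Adj u' w) : False := by
  have hno : ∀ S, G.IsHole S → u ∈ S → u' ∉ S := fun S hS h h' =>
    hadj.ne (hC.2 S hS ⟨h, hu⟩ ⟨h', hu'⟩)
  have hu'S := hno S hS huS
  have huS' : u ∉ S' := fun h => hno S' hS' h hu'S'
  have hne : u ≠ w := fun h => huS' (h ▸ hwS')
  have hne' : u' ≠ w := fun h => hu'S (h ▸ hwS)
  obtain ⟨X, Y, x, y, s, t, hX, hY, hXS, hYS, -, -, hst, hst'⟩ := hS.exists_arms huS hwS hne huw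
  obtain ⟨P, Q, p, q, a, b, hP, hQ, hPS, hQS, -, -, hab, hab'⟩ :=
    hS'.exists_arms hu'S' hwS' hne' hu'w
  -- if `u'` misses the first vertex of an arm of `S`, then `u` sees both arms of `S'`
  have key : ∀ X x s P p a, G.IsArm u w X x s → X ⊆ S → ¬ G.Adj u' x → G.IsArm u' w P p a →
      P ⊆ S' → ∃ c ∈ P, G.Adj u c := by
    intro X x s P p a hX hXS hu'x hP hPS
    by_contra! hcon
    have hxX := hX.symm.right_mem
    have hlink : G.LinkedIn (insert u' (insert w (P ∪ X))) u' x := by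
      have h1 := ((hP.linked a hP.right_mem).mono Set.subset_union_left : G.LinkedIn (P ∪ X) p a)
      have h2 := ((hX.linked s hX.right_mem).mono Set.subset_union_right : G.LinkedIn (P ∪ X) x s)
      have hsub : P ∪ X ⊆ insert u' (insert w (P ∪ X)) :=
        (Set.subset_insert _ _).trans (Set.subset_insert _ _)
      exact ((((LinkedIn.of_adj hP.left_adj (by simp) (hsub h1.left_mem)).trans
        (h1.mono hsub)).trans (.of_adj hP.right_adj.symm (hsub h1.right_mem) (by simp))).trans
        (.of_adj hX.right_adj (by simp) (hsub h2.right_mem))).trans (h2.symm.mono hsub)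
    obtain ⟨T, hT, huT, hu'T, -⟩ := exists_isHole_of_linkedIn hadj hX.left_adj
      (fun h => hu'S (h ▸ hXS hxX)) hu'x
      (by
        rintro (h | h | h | h)
        exacts [hadj.ne h, hne h, huS' (hPS h), hX.left_notMem h])
      (by
        rintro c (rfl | rfl | h | h) hc
        exacts [Or.inl rfl, absurd hc huw, absurd hc (hcon c h), Or.inr (hX.eq_left c h hc)]) hlink
    exact hno T hT huT hu'T
  have hends : ¬ (G.Adj u' x ∧ G.Adj u' y) := by
    rintro ⟨hx, hy⟩
    refine (hC.1 u hu).not_linkedIn hS huS hwS (hXS hX.right_mem) (hYS hY.right_mem) hne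
      hX.right_adj hY.right_adj hst hst' (D := insert u' (X ∪ Y)) ?_ ?_ ?_ ?_
    · rintro (h | h | h)
      exacts [hne' h.symm, hX.right_notMem h, hY.right_notMem h]
    · rintro (h | h | h)
      exacts [hadj.ne h, hX.left_notMem h, hY.left_notMem h]
    · rintro c (rfl | h | h) hc
      exacts [absurd hc.symm hu'w, Or.inl (hX.eq_right c h hc), Or.inr (hY.eq_right c h hc)]
    · have h1 := (hX.linked s hX.right_mem).mono (Set.subset_union_left.trans
        (Set.subset_insert u' (X ∪ Y)))
      have h2 := (hY.linked t hY.right_mem).mono (Set.subset_union_right.trans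
        (Set.subset_insert u' (X ∪ Y)))
      exact ((h1.symm.trans (.of_adj hx.symm h1.left_mem (by simp))).trans
        (.of_adj hy (by simp) h2.left_mem)).trans h2
  have hends' : (∃ c ∈ P, G.Adj u c) ∧ ∃ c ∈ Q, G.Adj u c := by
    by_cases hx : G.Adj u' x
    · have hy : ¬ G.Adj u' y := fun hy => hends ⟨hx, hy⟩
      exact ⟨key Y y t P p a hY hYS hy hP hPS, key Y y t Q q b hY hYS hy hQ hQS⟩
    · exact ⟨key X x s P p a hX hXS hx hP hPS, key X x s Q q b hX hXS hx hQ hQS⟩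
  obtain ⟨⟨c, hcP, huc⟩, d, hdQ, hud⟩ := hends'
  refine (hC.1 u' hu').not_linkedIn hS' hu'S' hwS' (hPS hP.right_mem) (hQS hQ.right_mem) hne'
    hP.right_adj hQ.right_adj hab hab' (D := insert u (P ∪ Q)) ?_ ?_ ?_ ?_
  · rintro (h | h | h)
    exacts [hne h.symm, hP.right_notMem h, hQ.right_notMem h]
  · rintro (h | h | h)
    exacts [hadj.ne h.symm, hP.left_notMem h, hQ.left_notMem h]
  · rintro e (rfl | h | h) he
    exacts [absurd he.symm huw, Or.inl (hP.eq_right e h he), Or.inr (hQ.eq_right e h he)]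
  · have h1 := (hP.symm.linked c hcP).mono (Set.subset_union_left.trans
      (Set.subset_insert u (P ∪ Q)))
    have h2 := (hQ.symm.linked d hdQ).mono (Set.subset_union_right.trans
      (Set.subset_insert u (P ∪ Q)))
    exact ((h1.trans (.of_adj huc.symm h1.right_mem (by simp))).trans
      (.of_adj hud (by simp) h2.right_mem)).trans h2.symm

/-- In a clique of the local chordalization, the new edges form a star: two of them with different
ends `u`, `u'` in `C` cannot occur together. -/
lemma SetNC.false_of_new_edges {C : Set V} (hC : G.SetNC C) {u u' w w' : V} (hu : u ∈ C)
    (hu' : u' ∈ C) (huu' : u ≠ u') {S S' : Set V} (hS : G.IsHole S) (hS' : G.IsHole S')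
    (huS : u ∈ S) (hwS : w ∈ S) (huw : u ≠ w) (hnuw : ¬ G.Adj u w)
    (hu'S' : u' ∈ S') (hwS' : w' ∈ S') (hu'w' : u' ≠ w') (hnu'w' : ¬ G.Adj u' w')
    (hcl : ∀ a ∈ ({u, u', w, w'} : Set V), ∀ b ∈ ({u, u', w, w'} : Set V), a ≠ b →
      G.Adj a b ∨ ∃ S, G.IsHole S ∧ a ∈ S ∧ b ∈ S ∧ (a ∈ C ∨ b ∈ C)) : False := by
  have hno : ∀ S, G.IsHole S → ∀ a ∈ C, ∀ b ∈ C, a ∈ S → b ∈ S → a = b :=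
    fun S hS a ha b hb h h' => hC.2 S hS ⟨h, ha⟩ ⟨h', hb⟩
  have hwC : w ∉ C := fun h => huw (hno S hS u hu w h huS hwS)
  have hwC' : w' ∉ C := fun h => hu'w' (hno S' hS' u' hu' w' h hu'S' hwS')
  have hadj : G.Adj u u' := by
    rcases hcl u (by simp) u' (by simp) huu' with h | ⟨T, hT, h1, h2, -⟩
    exacts [h, absurd (hno T hT u hu u' hu' h1 h2) huu']
  by_cases hww : w = w'
  · subst hww
    exact hC.false_of_isHole_of_isHole hu hu' hadj hS hS' huS hwS hu'S' hwS' hnuw hnu'w'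
  have hww' : G.Adj w w' := by
    rcases hcl w (by simp) w' (by simp) hww with h | ⟨T, hT, h1, h2, h3⟩
    exacts [h, absurd h3 (by simp [hwC, hwC'])]
  have huw' : G.Adj u w' := by
    by_contra hn
    rcases hcl u (by simp) w' (by simp) (by rintro rfl; exact hwC' hu) with h | ⟨T, hT, h1, h2, -⟩
    exacts [hn h,
      hC.false_of_isHole_of_isHole hu hu' hadj hT hS' h1 h2 hu'S' hwS' hn hnu'w']
  have hu'w : G.Adj u' w := by
    by_contra hn
    rcases hcl u' (by simp) w (by simp) (by rintro rfl; exact hwC hu') with h | ⟨T, hT, h1, h2, -⟩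
    exacts [hn h,
      hC.false_of_isHole_of_isHole hu hu' hadj hS hT huS hwS h1 h2 hnuw hn]
  -- now `u w' w u'` is a hole with two vertices in `C`
  obtain ⟨T, hT, huT, -, hu'T, -⟩ := exists_isHole_of_linkedIn (D := {w', w, u'}) huw' hadj
    hu'w'.symm (fun h => hnu'w' h.symm) (by simp [huw'.ne, huw, huu'])
    (by
      rintro c (rfl | rfl | rfl) hc
      exacts [Or.inl rfl, absurd hc hnuw, Or.inr rfl])
    ((LinkedIn.of_adj hww'.symm (by simp) (by simp)).trans (.of_adj hu'w.symm (by simp) (by simp)))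
  exact huu' (hno T hT u hu u' hu' huT hu'T)

/-! ### Iterated fillings -/

/-- Vertices other than `z` that are `a`, `b` or non-neighbours of `z`. -/
def avoiding (G : SimpleGraph V) (z a b : V) : Set V :=
  {c | c ≠ z ∧ (c = a ∨ c = b ∨ ¬ G.Adj z c)}

/-- What is known of an added edge `ab`: its ends lie on holes of `G`, and a vertex `z` on no hole
of `G` is adjacent to both ends, or else `a` and `b` are linked in `G` around the neighbours
of `z`. -/
def IsFillPair (G : SimpleGraph V) (a b : V) : Prop :=
  a ∈ G.holeUnion ∧ b ∈ G.holeUnion ∧ ∀ z, z ∉ G.holeUnion →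
    (G.Adj z a ∧ G.Adj z b) ∨ G.LinkedIn (G.avoiding z a b) a b

lemma avoiding_comm (z a b : V) : G.avoiding z a b = G.avoiding z b a := by
  ext c; simp only [avoiding, Set.mem_ofPred_eq]; tauto

/-- `A` arises from the subgraph of `G` induced by `W` by adding fill pairs, in such a way that
every clique of `A ⊔ G` becomes a clique of `G` by deleting at most `t` vertices. The vertices
outside `W` are isolated in `A`. -/
structure IsFilling (G : SimpleGraph V) (W : Set V) (t : ℕ) (A : SimpleGraph V) : Prop where
  mem : ∀ a b, A.Adj a b → a ∈ W
  adj : ∀ a b, G.Adj a b → a ∈ W → b ∈ W → A.Adj a b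
  fill : ∀ a b, A.Adj a b → G.Adj a b ∨ G.IsFillPair a b
  clique : ∀ K : Finset V, (A ⊔ G).IsClique (K : Set V) →
    ∃ X : Finset V, X.card ≤ t ∧ G.IsClique ((K : Set V) \ X)

/-- Two neighbours of a vertex on no hole that are linked around its other neighbours are
adjacent. -/
lemma adj_of_linkedIn_avoiding {z a b : V} (hz : z ∉ G.holeUnion) (hza : G.Adj z a) (hzb : G.Adj z b)
    (hne : a ≠ b) (h : G.LinkedIn (G.avoiding z a b) a b) : G.Adj a b := by
  by_contra hab
  obtain ⟨S, hS, hzS, -⟩ := exists_isHole_of_linkedIn hza hzb hne hab (fun h => h.1 rfl)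
    (fun c hc hzc => by
      rcases hc.2 with h | h | h
      exacts [Or.inl h, Or.inr h, absurd hzc h]) h
  exact hz ⟨S, hS, hzS⟩

namespace IsFilling

variable {W : Set V} {t : ℕ} {A : SimpleGraph V}

lemma mem_of_isHole (hA : G.IsFilling W t A) {S : Set V} (hS : A.IsHole S) {a : V} (ha : a ∈ S) :
    a ∈ W := by
  obtain ⟨n, g, hg, rfl, -⟩ := hS.exists_isHoleCycle ha
  exact hA.mem _ _ (hg.adj_succ (by have := hg.four_le; omega))

/-- An arc of a hole of `A` whose inner vertices are not neighbours of `z` can be replaced, edge by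
edge, by a linkage in `G` around the neighbours of `z`. -/
lemma linkedIn_arc (hA : G.IsFilling W t A) {n : ℕ} {g : ℕ → V} (hg : A.IsHoleCycle n g) {z : V}
    (hz : z ∉ G.holeUnion) {i j : ℕ} (hij : i < j) (hj : j ≤ n)
    (hne : ∀ k, i ≤ k → k ≤ j → g k ≠ z) (hint : ∀ k, i < k → k < j → ¬ G.Adj z (g k))
    (hends : i + 2 ≤ j ∨ ¬ (G.Adj z (g i) ∧ G.Adj z (g j))) :
    G.LinkedIn (G.avoiding z (g i) (g j)) (g i) (g j) := by
  have hmem : ∀ k, i ≤ k → k ≤ j → g k ∈ G.avoiding z (g i) (g j) := by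
    intro k h1 h2
    refine ⟨hne k h1 h2, ?_⟩
    rcases (by omega : k = i ∨ k = j ∨ (i < k ∧ k < j)) with rfl | rfl | h
    exacts [Or.inl rfl, Or.inr (Or.inl rfl), Or.inr (Or.inr (hint k h.1 h.2))]
  refine LinkedIn.of_succ hij.le (fun k h1 h2 => ?_) (hmem i le_rfl hij.le)
  rcases hA.fill _ _ (hg.adj_succ (i := k) (by omega)) with h | ⟨-, -, h⟩
  · exact .of_adj h (hmem k h1 h2.le) (hmem _ (by omega) (by omega))
  rcases h z hz with ⟨ha, hb⟩ | h
  · exfalso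
    have hki : k = i := by
      by_contra hki
      exact hint k (by omega) h2 ha
    have hkj : k + 1 = j := by
      by_contra hkj
      exact hint (k + 1) (by omega) (by omega) hb
    rcases hends with h | h
    · omega
    · exact h ⟨hki ▸ ha, hkj ▸ hb⟩
  · refine h.mono ?_
    rintro c ⟨hcz, rfl | rfl | hc⟩
    exacts [hmem k h1 h2.le, hmem _ (by omega) (by omega), ⟨hcz, Or.inr (Or.inr hc)⟩]

/-- Filling creates no holes outside `Ω(G)`: on a hole of `A` through `z ∉ Ω(G)`, both neighbours
of `z` are original neighbours and the rest of the hole links them around `z`. -/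
lemma mem_holeUnion (hA : G.IsFilling W t A) {S : Set V} (hS : A.IsHole S) {z : V} (hzS : z ∈ S) :
    z ∈ G.holeUnion := by
  by_contra hz
  have hW := fun a => hA.mem_of_isHole hS (a := a)
  obtain ⟨n, g, hg, rfl, rfl⟩ := hS.exists_isHoleCycle hzS
  have h4 := hg.four_le
  have hgW : ∀ k < n, g k ∈ W := fun k hk => hW _ ⟨k, hk, rfl⟩
  have hG : ∀ b, A.Adj (g 0) b → G.Adj (g 0) b := fun b h =>
    (hA.fill _ _ h).resolve_right fun h => hz h.1
  have h := hA.linkedIn_arc hg hz (i := 1) (j := n - 1) (by omega) (by omega)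
    (fun k h1 h2 => (hg.ne 0 k (by omega) (by omega)).symm)
    (fun k h1 h2 h => by
      have := (hg.adj_iff 0 k (by omega) (by omega)).1
        (hA.adj _ _ h (hgW 0 (by omega)) (hgW k (by omega)))
      omega) (Or.inl (by omega))
  have h' := adj_of_linkedIn_avoiding hz (hG _ ((hg.adj_iff 0 1 (by omega) (by omega)).2 (Or.inl rfl)))
    (hG _ ((hg.adj_iff 0 (n - 1) (by omega) (by omega)).2 (Or.inr ⟨rfl, rfl⟩)))
    (hg.ne _ _ (by omega) (by omega)) h
  have := (hg.adj_iff 1 (n - 1) (by omega) (by omega)).1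
    (hA.adj _ _ h' (hgW 1 (by omega)) (hgW _ (by omega)))
  omega

/-- A vertex `z` on no hole of `G` and not adjacent to the vertex `a` of a hole of `A` cannot
separate `a` from another vertex `b` of this hole: if `z` has neighbours on both arcs from `a`
to `b`, those nearest to `a` are linked around `z` through `a`, which gives a hole through `z`. -/
lemma linkedIn_of_not_adj (hA : G.IsFilling W t A) {S : Set V} (hS : A.IsHole S) {a b z : V}
    (ha : a ∈ S) (hb : b ∈ S) (hne : a ≠ b) (hz : z ∉ G.holeUnion) (hza : ¬ G.Adj z a) :
    G.LinkedIn (G.avoiding z a b) a b := by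
  have hW := fun a => hA.mem_of_isHole hS (a := a)
  have hΩ := fun a => hA.mem_holeUnion hS (z := a)
  obtain ⟨n, g, hg, rfl, rfl⟩ := hS.exists_isHoleCycle ha
  obtain ⟨j, hj, rfl⟩ := hb
  have hjn : j < n := hj
  have h4 := hg.four_le
  have hj0 : 0 < j := Nat.pos_of_ne_zero (by rintro rfl; exact hne rfl)
  have hgz : ∀ k ≤ n, g k ≠ z := by
    rintro k hk rfl
    rcases hk.lt_or_eq with hk | rfl
    · exact hz (hΩ _ ⟨k, hk, rfl⟩)
    · exact hz (hΩ _ ⟨0, show 0 < k by omega, hg.closed.symm⟩)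
  by_cases h1 : ∀ k, 0 < k → k < j → ¬ G.Adj z (g k)
  · exact hA.linkedIn_arc hg hz hj0 hjn.le (fun k _ hk => hgz k (by omega)) h1
      (Or.inr fun h => hza h.1)
  by_cases h2 : ∀ k, j < k → k < n → ¬ G.Adj z (g k)
  · have h := hA.linkedIn_arc hg hz hjn le_rfl (fun k _ hk => hgz k hk) h2
      (Or.inr fun h => hza (hg.closed ▸ h.2))
    rw [hg.closed, avoiding_comm] at h
    exact h.symm
  exfalso
  classical
  -- the neighbour of `z` nearest to `a` on the first arc
  have h1' : ∃ k, 0 < k ∧ k < j ∧ G.Adj z (g k) := by push Not at h1; exact h1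
  obtain ⟨hi0, hij, hzi⟩ := Nat.find_spec h1'
  have hmin := fun k (hk : k < Nat.find h1') => Nat.find_min h1' hk
  generalize Nat.find h1' = i at hi0 hij hzi hmin
  -- and the one nearest to `a` on the second arc
  have h2' : ∃ m, 0 < m ∧ m < n - j ∧ G.Adj z (g (n - m)) := by
    push Not at h2
    obtain ⟨k, hk1, hk2, hk⟩ := h2
    exact ⟨n - k, by omega, by omega, by rwa [Nat.sub_sub_self hk2.le]⟩
  obtain ⟨hm0, hmj, hzm⟩ := Nat.find_spec h2'
  have hmin' := fun k (hk : k < Nat.find h2') => Nat.find_min h2' hk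
  generalize Nat.find h2' = m at hm0 hmj hzm hmin'
  have hl1 := hA.linkedIn_arc hg hz hi0 (by omega) (fun k _ hk => hgz k (by omega))
    (fun k hk hk' h => hmin k hk' ⟨hk, by omega, h⟩) (Or.inr fun h => hza h.1)
  have hl2 := hA.linkedIn_arc hg hz (i := n - m) (j := n) (by omega) le_rfl
    (fun k _ hk => hgz k (by omega))
    (fun k hk hk' h => hmin' (n - k) (by omega)
      ⟨by omega, by omega, by rwa [Nat.sub_sub_self hk'.le]⟩)
    (Or.inr fun h => hza (hg.closed ▸ h.2))
  rw [hg.closed] at hl2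
  have hlink : G.LinkedIn (G.avoiding z (g i) (g (n - m))) (g i) (g (n - m)) := by
    refine (hl1.symm.mono ?_).trans (hl2.symm.mono ?_)
    · rintro c ⟨hc, rfl | h | h⟩
      exacts [⟨hc, Or.inr (Or.inr hza)⟩, ⟨hc, Or.inl h⟩, ⟨hc, Or.inr (Or.inr h)⟩]
    · rintro c ⟨hc, h | rfl | h⟩
      exacts [⟨hc, Or.inr (Or.inl h)⟩, ⟨hc, Or.inr (Or.inr hza)⟩, ⟨hc, Or.inr (Or.inr h)⟩]
  have hadj := adj_of_linkedIn_avoiding hz hzi hzm (hg.ne _ _ (by omega) (by omega)) hlink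
  have := (hg.adj_iff i (n - m) (by omega) (by omega)).1
    (hA.adj _ _ hadj (hW _ ⟨i, show i < n by omega, rfl⟩)
      (hW _ ⟨n - m, show n - m < n by omega, rfl⟩))
  omega

lemma isFillPair (hA : G.IsFilling W t A) {S : Set V} (hS : A.IsHole S) {a b : V} (ha : a ∈ S)
    (hb : b ∈ S) (hne : a ≠ b) : G.IsFillPair a b := by
  refine ⟨hA.mem_holeUnion hS ha, hA.mem_holeUnion hS hb, fun z hz => ?_⟩
  by_cases hza : G.Adj z a
  · by_cases hzb : G.Adj z b
    · exact Or.inl ⟨hza, hzb⟩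
    · right
      rw [avoiding_comm]
      exact (hA.linkedIn_of_not_adj hS hb ha hne.symm hz hzb).symm
  · exact Or.inr (hA.linkedIn_of_not_adj hS ha hb hne hz hza)

lemma removeVerts (G : SimpleGraph V) (C : Set V) : G.IsFilling Cᶜ 0 (G.removeVerts C) where
  mem _ _ h := h.2.1
  adj _ _ h ha hb := ⟨h, ha, hb⟩
  fill _ _ h := Or.inl h.1
  clique K hK := by
    refine ⟨∅, by simp, ?_⟩
    have hle : G.removeVerts C ≤ G := fun _ _ h => h.1
    rw [sup_eq_right.2 hle] at hK
    simpa using hK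

lemma sup_removeVerts (hA : G.IsFilling W t A) {C : Set V} (hC : W ⊆ Cᶜ) :
    G.IsFilling Cᶜ t (A ⊔ G.removeVerts C) where
  mem a b h := h.elim (fun h => hC (hA.mem a b h)) (fun h => h.2.1)
  adj a b h ha hb := Or.inr ⟨h, ha, hb⟩
  fill a b h := h.elim (hA.fill a b) (fun h => Or.inl h.1)
  clique K hK := by
    have hle : G.removeVerts C ≤ G := fun _ _ h => h.1
    rw [sup_assoc, sup_eq_right.2 hle] at hK
    exact hA.clique K hK

/-- One step of a local chordalization partition costs one more vertex in every clique. -/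
lemma localChordalization (hA : G.IsFilling W t A) {C : Set V} (hC : A.SetNC C)
    {B : SimpleGraph V} (hB : A.IsLocalChordalization C B) : G.IsFilling W (t + 1) B where
  mem a b h := by
    rcases (hB.adj hC).2 a b h with h | ⟨S, hS, ha, -⟩
    exacts [hA.mem a b h, hA.mem_of_isHole hS ha]
  adj a b h ha hb := (hB.adj hC).1 (hA.adj a b h ha hb)
  fill a b hab := by
    rcases (hB.adj hC).2 a b hab with h | ⟨S, hS, ha, hb, -⟩
    exacts [hA.fill a b h, Or.inr (hA.isFillPair hS ha hb hab.ne)]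
  clique K hK := by
    classical
    -- an edge of the clique that is not yet in `A ⊔ G` starts in `C`
    have hnew : ∀ L ⊆ K, ¬ (A ⊔ G).IsClique (L : Set V) → ∃ u ∈ L, ∃ w ∈ L, u ≠ w ∧ u ∈ C ∧
        ¬ A.Adj u w ∧ ∃ S, A.IsHole S ∧ u ∈ S ∧ w ∈ S := by
      intro L hLK hL
      simp only [IsClique, Set.Pairwise, not_forall] at hL
      obtain ⟨a, ha, b, hb, hne, hab⟩ := hL
      have hab' : B.Adj a b := by
        rcases hK (hLK ha) (hLK hb) hne with h | h
        exacts [h, absurd (Or.inr h) hab]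
      have hnA : ¬ A.Adj a b := fun h => hab (Or.inl h)
      rcases (hB.adj hC).2 a b hab' with h | ⟨S, hS, haS, hbS, haC | hbC⟩
      · exact absurd h hnA
      · exact ⟨a, ha, b, hb, hne, haC, hnA, S, hS, haS, hbS⟩
      · exact ⟨b, hb, a, ha, hne.symm, hbC, fun h => hnA h.symm, S, hS, hbS, haS⟩
    by_cases hKA : (A ⊔ G).IsClique (K : Set V)
    · obtain ⟨X, hX, hKX⟩ := hA.clique K hKA
      exact ⟨X, by omega, hKX⟩
    obtain ⟨u, huK, w, hwK, huw, huC, hnuw, S, hS, huS, hwS⟩ := hnew K subset_rfl hKA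
    by_cases hKu : (A ⊔ G).IsClique ((K.erase u : Finset V) : Set V)
    · obtain ⟨X, hX, hKX⟩ := hA.clique _ hKu
      refine ⟨insert u X, (Finset.card_insert_le _ _).trans (by omega), hKX.subset ?_⟩
      intro c hc
      simp only [Finset.coe_insert, Set.mem_sdiff, Finset.mem_coe, Set.mem_insert_iff, not_or,
        Finset.coe_erase, Set.mem_singleton_iff] at hc ⊢
      tauto
    exfalso
    obtain ⟨u', hu'K, w', hw'K, huw', hu'C, hnuw', S', hS', huS', hwS'⟩ :=
      hnew _ (Finset.erase_subset _ _) hKu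
    rw [Finset.mem_erase] at hu'K hw'K
    refine hC.false_of_new_edges huC hu'C hu'K.1.symm hS hS' huS hwS huw hnuw huS' hwS' huw' hnuw' ?_
    have hW : ∀ a ∈ ({u, u', w, w'} : Set V), a ∈ K ∧ a ∈ W := by
      rintro a (rfl | rfl | rfl | rfl)
      exacts [⟨huK, hA.mem_of_isHole hS huS⟩, ⟨hu'K.2, hA.mem_of_isHole hS' huS'⟩,
        ⟨hwK, hA.mem_of_isHole hS hwS⟩, ⟨hw'K.2, hA.mem_of_isHole hS' hwS'⟩]
    intro a ha b hb hne
    rcases hK (hW a ha).1 (hW b hb).1 hne with h | h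
    · exact (hB.adj hC).2 a b h
    · exact Or.inl (hA.adj a b h (hW a ha).2 (hW b hb).2)

end IsFilling

/-! ### Local chordalization partitions -/

lemma IsLocalChordalizationPartition.exists_isFilling {C : Set V} {k : ℕ} {P : Fin k → Set V}
    (h : G.IsLocalChordalizationPartition C P) (hk : 0 < k) :
    ∃ B : SimpleGraph V, B.IsChordal ∧ G.IsFilling Set.univ k B := by
  obtain ⟨-, -, hC, A, B, hB0, hAB⟩ := h
  have key : ∀ i (hi : i < k + 1),
      G.IsFilling (⋃ j : Fin k, ⋃ _ : i ≤ j.val, P j)ᶜ i (B ⟨i, hi⟩) := by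
    intro i
    induction i with
    | zero =>
      intro hi
      have h0 : (⋃ j : Fin k, ⋃ _ : 0 ≤ j.val, P j) = C := by simp [← hC]
      rw [h0]
      exact hB0 ▸ IsFilling.removeVerts G C
    | succ i ih =>
      intro hi
      obtain ⟨hA, -, hNC, hloc, -⟩ := hAB ⟨i, by omega⟩
      have h1 := (ih (by omega)).sup_removeVerts (C := ⋃ j : Fin k, ⋃ _ : i + 1 ≤ j.val, P j) (by
        refine Set.compl_subset_compl.2 (Set.iUnion_mono fun j => ?_)
        exact Set.iUnion_mono' fun hj => ⟨by omega, subset_rfl⟩)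
      have h2 : G.IsFilling _ i (A ⟨i, by omega⟩) := hA ▸ h1
      exact h2.localChordalization hNC hloc
  obtain ⟨k, rfl⟩ : ∃ k', k = k' + 1 := ⟨k - 1, by omega⟩
  refine ⟨B (Fin.last _), (hAB (Fin.last k)).2.2.2.2, ?_⟩
  have h := key (k + 1) (by omega)
  have h0 : (⋃ j : Fin (k + 1), ⋃ _ : k + 1 ≤ j.val, P j)ᶜ = Set.univ := by
    rw [Set.compl_univ_iff, Set.iUnion_eq_empty]
    exact fun j => Set.iUnion_eq_empty.2 fun hj => absurd j.isLt (by omega)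
  rwa [h0] at h

/-- Every graph with a vertex has a local chordalization partition: the partition of the whole
vertex set into singletons. When `v` is put back, all holes pass through `v`. -/
lemma exists_isLocalChordalizationPartition [Finite V] [Nonempty V] (G : SimpleGraph V) :
    ∃ k, 0 < k ∧ ∃ (C : Set V) (P : Fin k → Set V), G.IsLocalChordalizationPartition C P := by
  obtain ⟨k, ⟨e⟩⟩ := Finite.exists_equiv_fin V
  let f := e.symm
  let A : Fin k → SimpleGraph V → SimpleGraph V := fun i B =>
    B ⊔ G.removeVerts (⋃ j : Fin k, ⋃ _ : i < j, {f j})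
  let B : ℕ → SimpleGraph V := fun i => Nat.rec (G.removeVerts Set.univ)
    (fun i B => if h : i < k then (A ⟨i, h⟩ B).localChordalize (f ⟨i, h⟩) else B) i
  have hBs : ∀ i : Fin k, B (i.val + 1) = (A i (B i)).localChordalize (f i) := fun i =>
    dif_pos i.isLt
  have hholes : ∀ i : Fin k, (B i).IsChordal →
      (∀ a b, G.Adj a b → (∀ j : Fin k, i ≤ j → a ≠ f j ∧ b ≠ f j) → (B i).Adj a b) →
      ∀ S, (A i (B i)).IsHole S → f i ∈ S := by
    intro i hch hadj S hS
    by_contra hiS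
    refine hch S (hS.of_adj_iff fun a ha b hb => ⟨?_, fun h => Or.inl h⟩)
    rintro (h | ⟨h, haj, hbj⟩)
    · exact h
    · simp only [Set.mem_iUnion, Set.mem_singleton_iff, exists_prop, not_exists, not_and]
        at haj hbj
      refine hadj a b h fun j hj => ?_
      rcases hj.eq_or_lt with rfl | hj
      · exact ⟨fun h => hiS (h ▸ ha), fun h => hiS (h ▸ hb)⟩
      · exact ⟨haj j hj, hbj j hj⟩
  have hinv : ∀ i, i ≤ k → (B i).IsChordal ∧
      ∀ a b, G.Adj a b → (∀ j : Fin k, i ≤ j.val → a ≠ f j ∧ b ≠ f j) → (B i).Adj a b := by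
    intro i
    induction i with
    | zero =>
      refine fun _ => ⟨?_, fun a b _ h => absurd (e.symm_apply_apply a).symm (h (e a) (by omega)).1⟩
      rintro S ⟨n, hn, g, -⟩
      have hadj : (cycleGraph n).Adj ⟨0, by omega⟩ ⟨1, by omega⟩ :=
        (cycleGraph_adj_iff_of_lt hn (by simp)).2 (Or.inl rfl)
      exact (g.map_adj_iff.2 hadj).2.1 trivial
    | succ i ih =>
      intro hi
      obtain ⟨hch, hadj⟩ := ih (by omega)
      rw [hBs ⟨i, hi⟩]
      refine ⟨isChordal_localChordalize (hholes ⟨i, hi⟩ hch hadj), fun a b hab h => ?_⟩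
      refine Or.inl (Or.inr ⟨hab, ?_, ?_⟩) <;>
        simp only [Set.mem_iUnion, Set.mem_singleton_iff, exists_prop, not_exists, not_and]
      exacts [fun j hj => (h j hj).1, fun j hj => (h j hj).2]
  have hk : 0 < k := Fin.pos (e (Classical.arbitrary V))
  refine ⟨k, hk, Set.univ, fun i => {f i}, ⟨Set.univ_nonempty, fun S hS => ?_⟩, fun i j hij => ?_,
    ?_, fun i => A i (B i), fun i => B i, rfl, fun i => ?_⟩
  · obtain ⟨n, hn, g, rfl⟩ := hS
    exact ⟨g ⟨0, by omega⟩, ⟨_, rfl⟩, trivial⟩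
  · exact Set.disjoint_singleton.2 (f.injective.ne hij)
  · exact Set.eq_univ_of_forall fun v => Set.mem_iUnion.2 ⟨e v, (e.symm_apply_apply v).symm⟩
  · obtain ⟨hch, hadj⟩ := hinv i i.isLt.le
    have hA := hholes i hch hadj
    refine ⟨rfl, ⟨Set.singleton_nonempty _, fun S hS => ⟨f i, hA S hS, rfl⟩⟩, ⟨?_, ?_⟩,
      ⟨[f i], by simp, by simp, (hBs i).symm⟩, (hinv (i + 1) i.isLt).1⟩
    · rintro u rfl S T - - hT huT
      exact absurd (hA T hT) huT
    · rintro S - a ⟨-, rfl⟩ b ⟨-, rfl⟩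
      rfl

/-- A chordal filling of `G` whose cliques grow by at most the non-chordality index. -/
lemma exists_isFilling_nonChordalityIndex [Finite V] (hG : ¬ G.IsChordal) :
    ∃ B : SimpleGraph V, B.IsChordal ∧ G.IsFilling Set.univ G.nonChordalityIndex B := by
  have hne : Nonempty V := by
    simp only [IsChordal, not_forall, not_not] at hG
    obtain ⟨S, n, hn, f, -⟩ := hG
    exact ⟨f ⟨0, by omega⟩⟩
  rw [nonChordalityIndex, if_neg hG]
  obtain ⟨hpos, C, P, hP⟩ := Nat.sInf_mem
    (s := {k : ℕ | 0 < k ∧ ∃ (C : Set V) (P : Fin k → Set V),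
      G.IsLocalChordalizationPartition C P}) G.exists_isLocalChordalizationPartition
  exact hP.exists_isFilling hpos

/-! ### The clique number of the chordal completion -/

/-- In a filling, vertices on no hole of `G` keep their neighbourhoods, so they can play the part
of `K_n` in a copy of `I_m ∨ K_n` found in a large clique. -/
lemma IsFilling.cliqueNum_lt [Finite V] {m n t : ℕ} {B : SimpleGraph V}
    (hB : G.IsFilling Set.univ t B)
    (hfree : ¬ (SimpleGraph.join (⊥ : SimpleGraph (Fin m)) (⊤ : SimpleGraph (Fin n))).IsContained G)
    (hΩ : (G.induce G.holeUnion).cliqueNum + t ≤ m) : B.cliqueNum < m + n := by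
  classical
  by_contra! hlarge
  obtain ⟨K, hK⟩ := B.exists_isNClique_cliqueNum
  have hGB : G ≤ B := fun a b h => hB.adj a b h trivial trivial
  have hKcard : m + n ≤ K.card := hK.card_eq ▸ hlarge
  have hin : (K.filter (· ∈ G.holeUnion)).card ≤ m := by
    obtain ⟨X, hX, hKX⟩ := hB.clique (K.filter (· ∈ G.holeUnion)) (by
      rw [sup_eq_left.2 hGB]
      exact hK.isClique.subset (Finset.coe_subset.2 (Finset.filter_subset _ _)))
    set L := K.filter (· ∈ G.holeUnion) \ X with hL
    have hLΩ : ∀ v ∈ L, v ∈ G.holeUnion := fun v hv =>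
      (Finset.mem_filter.1 (Finset.mem_sdiff.1 hv).1).2
    have hcl : (G.induce G.holeUnion).IsClique
        ((L.subtype (· ∈ G.holeUnion) : Finset G.holeUnion) : Set G.holeUnion) := by
      intro a ha b hb hne
      have ha' : a.1 ∈ L := by simpa using ha
      have hb' : b.1 ∈ L := by simpa using hb
      refine hKX ?_ ?_ (fun h => hne (Subtype.ext h))
      · exact_mod_cast ha'
      · exact_mod_cast hb'
    have h1 := hcl.card_le_cliqueNum
    rw [Finset.card_subtype, Finset.filter_true_of_mem hLΩ] at h1
    have h2 := Finset.le_card_sdiff X (K.filter (· ∈ G.holeUnion))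
    rw [← hL] at h2
    omega
  have hout : n ≤ (K.filter (· ∉ G.holeUnion)).card := by
    have := Finset.card_filter_add_card_filter_not (s := K) (· ∈ G.holeUnion)
    omega
  obtain ⟨N, hN, hNcard⟩ := Finset.exists_subset_card_eq hout
  have hNK : N ⊆ K := hN.trans (Finset.filter_subset _ _)
  have hM : m ≤ (K \ N).card := by
    rw [Finset.card_sdiff_of_subset hNK]; omega
  obtain ⟨M, hMK, hMcard⟩ := Finset.exists_subset_card_eq hM
  have hadj : ∀ a ∈ N, ∀ b ∈ K, a ≠ b → G.Adj a b := fun a ha b hb hne =>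
    (hB.fill a b (hK.isClique (hNK ha) hb hne)).resolve_right fun h =>
      (Finset.mem_filter.1 (hN ha)).2 h.1
  let p : Fin m ≃ M := (M.equivFinOfCardEq hMcard).symm
  let q : Fin n ≃ N := (N.equivFinOfCardEq hNcard).symm
  have hpq : ∀ i j, (p i : V) ≠ q j := fun i j h =>
    (Finset.mem_sdiff.1 (hMK (p i).2)).2 (h ▸ (q j).2)
  have hpK : ∀ i, (p i : V) ∈ K := fun i => (Finset.mem_sdiff.1 (hMK (p i).2)).1
  refine hfree ⟨⟨⟨Sum.elim (fun i => (p i : V)) (fun j => (q j : V)), ?_⟩, ?_⟩⟩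
  · rintro (i | i) (j | j) h
    · simp [join] at h
    · exact (hadj _ (q j).2 _ (hpK i) (hpq i j).symm).symm
    · exact hadj _ (q i).2 _ (hpK j) (hpq j i).symm
    · have hij : i ≠ j := by
        rintro rfl
        exact h.ne rfl
      exact hadj _ (q i).2 _ (hNK (q j).2) fun h => hij (q.injective (Subtype.ext h))
  · rintro (i | i) (j | j) h
    · exact congrArg Sum.inl (p.injective (Subtype.ext h))
    · exact absurd h (hpq i j)
    · exact absurd h.symm (hpq j i)
    · exact congrArg Sum.inr (q.injective (Subtype.ext h))

/-! ### Simplicial vertices and DP-colorings -/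

/-- Every nonempty set `U` of vertices of a chordal graph contains a vertex whose neighbours in `U`
form a clique. For a largest connected `D ⊆ U` that has vertices of `U` outside its closed
neighbourhood, every neighbour of `D` is adjacent to all those vertices, and the neighbours of `D`
are pairwise adjacent; so a simplicial vertex of the outside part is simplicial in `U`. -/
lemma IsChordal.exists_simplicial (hG : G.IsChordal) (U : Finset V) (hU : U.Nonempty) :
    ∃ v ∈ U, ∀ a ∈ U, ∀ b ∈ U, G.Adj v a → G.Adj v b → a ≠ b → G.Adj a b := by
  classical
  induction U using Finset.strongInduction with
  | H U ih =>
    by_cases hcomp : ∀ a ∈ U, ∀ b ∈ U, a ≠ b → G.Adj a b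
    · obtain ⟨v, hv⟩ := hU
      exact ⟨v, hv, fun a ha b hb _ _ => hcomp a ha b hb⟩
    push Not at hcomp
    obtain ⟨a₀, ha₀, b₀, hb₀, hne₀, hab₀⟩ := hcomp
    let Q : Finset V → Prop := fun D => D.Nonempty ∧
      (∀ x ∈ D, ∀ y ∈ D, G.LinkedIn (D : Set V) x y) ∧ ∃ r ∈ U, r ∉ D ∧ ∀ d ∈ D, ¬ G.Adj d r
    obtain ⟨D, hD, hmax⟩ := Finset.exists_max_image (U.powerset.filter Q) Finset.card
      ⟨{a₀}, by
        simp only [Finset.mem_filter, Finset.mem_powerset, Finset.singleton_subset_iff]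
        refine ⟨ha₀, by simp, ?_, b₀, hb₀, by simpa using hne₀.symm, by simpa using hab₀⟩
        rintro x hx y hy
        obtain rfl := Finset.mem_singleton.1 hx
        obtain rfl := Finset.mem_singleton.1 hy
        exact .refl (by simp)⟩
    rw [Finset.mem_filter, Finset.mem_powerset] at hD
    obtain ⟨hDU, ⟨d₀, hd₀⟩, hconn, r₀, hr₀, hr₀D, hr₀n⟩ := hD
    let R := U.filter fun r => r ∉ D ∧ ∀ d ∈ D, ¬ G.Adj d r
    have hRU : R ⊂ U := Finset.filter_ssubset.2 ⟨d₀, hDU hd₀, fun h => h.1 hd₀⟩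
    obtain ⟨r, hrR, hr⟩ := ih R hRU ⟨r₀, Finset.mem_filter.2 ⟨hr₀, hr₀D, hr₀n⟩⟩
    have hrR' := Finset.mem_filter.1 hrR
    have hnbr : ∀ y ∈ U, y ∉ D → y ∉ R → ∃ d ∈ D, G.Adj d y := by
      intro y hy hyD hyR
      by_contra! h
      exact hyR (Finset.mem_filter.2 ⟨hy, hyD, h⟩)
    have hfull : ∀ y ∈ U, y ∉ D → y ∉ R → ∀ s ∈ R, G.Adj y s := by
      intro y hy hyD hyR s hs
      obtain ⟨d, hd, hdy⟩ := hnbr y hy hyD hyR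
      have hs' := Finset.mem_filter.1 hs
      by_contra hys
      have hQ : Q (insert y D) := by
        refine ⟨by simp, ?_, s, hs'.1, ?_, ?_⟩
        · have hy : ∀ x ∈ insert y D, G.LinkedIn ((insert y D : Finset V) : Set V) d x := by
            intro x hx
            rcases Finset.mem_insert.1 hx with rfl | hx
            · exact .of_adj hdy (by simp [hd]) (by simp)
            · exact (hconn d hd x hx).mono (by simp)
          exact fun x hx z hz => (hy x hx).symm.trans (hy z hz)
        · rw [Finset.mem_insert]
          rintro (rfl | h)
          exacts [hyR hs, hs'.2.1 h]
        · intro x hx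
          rcases Finset.mem_insert.1 hx with rfl | hx
          exacts [hys, hs'.2.2 x hx]
      have := hmax (insert y D) (Finset.mem_filter.2
        ⟨Finset.mem_powerset.2 (Finset.insert_subset hy hDU), hQ⟩)
      rw [Finset.card_insert_of_notMem hyD] at this
      omega
    refine ⟨r, hrR'.1, fun a ha b hb hra hrb hne => ?_⟩
    have haD : a ∉ D := fun h => hrR'.2.2 a h hra.symm
    have hbD : b ∉ D := fun h => hrR'.2.2 b h hrb.symm
    by_cases haR : a ∈ R
    · by_cases hbR : b ∈ R
      · exact hr a haR b hbR hra hrb hne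
      · exact (hfull b hb hbD hbR a haR).symm
    by_cases hbR : b ∈ R
    · exact hfull a ha haD haR b hbR
    obtain ⟨c, hc, hca⟩ := hnbr a ha haD haR
    obtain ⟨d, hd, hdb⟩ := hnbr b hb hbD hbR
    by_contra hab
    have hsub : (D : Set V) ⊆ insert a (insert b (D : Set V)) :=
      (Set.subset_insert _ _).trans (Set.subset_insert _ _)
    obtain ⟨S, hS, -⟩ := exists_isHole_of_linkedIn hra hrb hne hab
      (D := insert a (insert b (D : Set V)))
      (by
        rintro (h | h | h)
        exacts [hra.ne h, hrb.ne h, hrR'.2.1 h])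
      (by
        rintro x (rfl | rfl | h) hx
        exacts [Or.inl rfl, Or.inr rfl, absurd hx.symm (hrR'.2.2 x h)])
      (((LinkedIn.of_adj hca.symm (by simp) (hsub hc)).trans ((hconn c hc d hd).mono hsub)).trans
        (.of_adj hdb (hsub hd) (by simp)))
    exact hG S hS

/-- Colouring the vertices greedily, a simplicial vertex of the chordal completion after all
others. -/
lemma IsChordalCompletion.dpColorable [Finite V] {B : SimpleGraph V} (hB : G.IsChordalCompletion B)
    {k : ℕ} (hk : B.cliqueNum ≤ k) : G.DPColorable k := by
  classical
  intro 𝒞 hL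
  have key : ∀ U : Finset V, ∃ c : V → ℕ, (∀ v ∈ U, c v ∈ 𝒞.L v) ∧
      ∀ u ∈ U, ∀ v ∈ U, G.Adj u v → ¬ 𝒞.M u v (c u) (c v) := by
    intro U
    induction U using Finset.strongInduction with
    | H U ih =>
      rcases U.eq_empty_or_nonempty with rfl | hU
      · exact ⟨fun _ => 0, by simp, by simp⟩
      obtain ⟨v, hv, hsimp⟩ := hB.2.exists_simplicial U hU
      obtain ⟨c, hc, hcM⟩ := ih (U.erase v) (Finset.erase_ssubset hv)
      let N := U.filter fun u => B.Adj v u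
      have hN : N.card < k := by
        have hcl : B.IsClique ((insert v N : Finset V) : Set V) := by
          rw [Finset.coe_insert, isClique_insert]
          refine ⟨fun a ha b hb hne => ?_, fun b hb _ => (Finset.mem_filter.1 hb).2⟩
          have ha' := Finset.mem_filter.1 ha
          have hb' := Finset.mem_filter.1 hb
          exact hsimp a ha'.1 b hb'.1 ha'.2 hb'.2 hne
        have h := hcl.card_le_cliqueNum
        rw [Finset.card_insert_of_notMem (by simp [N])] at h
        omega
      -- each coloured neighbour `u` of `v` forbids at most one colour of `v`
      let F := N.biUnion fun u => (𝒞.L v).filter fun b => G.Adj u v ∧ 𝒞.M u v (c u) b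
      have hF : F.card < (𝒞.L v).card := by
        refine lt_of_le_of_lt (Finset.card_biUnion_le_card_mul _ _ 1 fun u hu => ?_)
          (by have := hL v; omega)
        refine Finset.card_le_one.2 fun b hb b' hb' => ?_
        have h1 := (Finset.mem_filter.1 hb).2
        exact 𝒞.matching u v _ _ _ h1.1 h1.2 (Finset.mem_filter.1 hb').2.2
      obtain ⟨b, hbL, hbF⟩ := Finset.exists_mem_notMem_of_card_lt_card hF
      have hgood : ∀ u ∈ U, G.Adj u v → ¬ 𝒞.M u v (c u) b := fun u hu huv hM =>
        hbF (Finset.mem_biUnion.2 ⟨u, Finset.mem_filter.2 ⟨hu, hB.1 huv.symm⟩,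
          Finset.mem_filter.2 ⟨hbL, huv, hM⟩⟩)
      refine ⟨Function.update c v b, fun u hu => ?_, fun u hu w hw huw => ?_⟩
      · by_cases huv : u = v
        · subst huv
          simpa using hbL
        · rw [Function.update_of_ne huv]
          exact hc u (Finset.mem_erase.2 ⟨huv, hu⟩)
      · by_cases huv : u = v
        · subst huv
          rw [Function.update_self, Function.update_of_ne huw.ne']
          exact fun h => hgood w hw huw.symm (𝒞.matched_symm _ _ _ _ huw h)
        by_cases hwv : w = v
        · subst hwv
          rw [Function.update_self, Function.update_of_ne huv]
          exact hgood u hu huw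
        rw [Function.update_of_ne huv, Function.update_of_ne hwv]
        exact hcM u (Finset.mem_erase.2 ⟨huv, hu⟩) w (Finset.mem_erase.2 ⟨hwv, hw⟩) huw
  have := Fintype.ofFinite V
  obtain ⟨c, hc, hcM⟩ := key Finset.univ
  exact ⟨c, fun v => hc v (Finset.mem_univ v),
    fun u v => hcM u (Finset.mem_univ u) v (Finset.mem_univ v)⟩

lemma DPColorable.dpChromaticNumber_le {k : ℕ} (h : G.DPColorable k) :
    G.dpChromaticNumber ≤ k :=
  iInf₂_le k h

end SimpleGraph

theorem mainTheorem12 {V : Type*} [Finite V] (G : SimpleGraph V) (m n : ℕ)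
    (hn : 1 ≤ n) (hmn : n ≤ m) (hG : ¬ G.IsChordal)
    (hfree : ¬ (SimpleGraph.join (⊥ : SimpleGraph (Fin m)) (⊤ : SimpleGraph (Fin n))).IsContained G)
    (hΩ : (G.induce G.holeUnion).cliqueNum + G.nonChordalityIndex ≤ m) :
    (∃ G' : SimpleGraph V, G.IsChordalCompletion G' ∧ G'.cliqueNum < m + n) ∧
      G.dpChromaticNumber < ((m + n : ℕ) : ℕ∞) := by
  obtain ⟨B, hBc, hB⟩ := SimpleGraph.exists_isFilling_nonChordalityIndex hG
  have hcomp : G.IsChordalCompletion B := ⟨fun a b h => hB.adj a b h trivial trivial, hBc⟩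
  have hlt := hB.cliqueNum_lt hfree hΩ
  exact ⟨⟨B, hcomp, hlt⟩,
    (hcomp.dpColorable le_rfl).dpChromaticNumber_le.trans_lt (by exact_mod_cast hlt)⟩
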